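/- **Setting.** Let $(X,T,Y)$ be random variables with law $P$, where $X\in\mathbb R^d$, $T\in\{0,1\}$ with $\pi_1=P(T=1)\in(0,1)$, and $Y$ is real and integrable. Write $P^0=P(\cdot\mid T=0)$, $P^1=P(\cdot\mid T=1)$, $m_0(x)=\mathbb E_{P^0}[Y\mid X=x]$, $e(x)=P(T=1\mid X=x)$. For a random variable $Z$ with laws $P^0_Z,P^1_Z$ under $P^0,P^1$, the overlap divergence is $$\mathcal O(Z)=\mathbb E_{P^0}\Big[\Big(\tfrac{dP^1_Z}{dP^0_Z}(Z)\Big)^2\Big]\in[1,\infty],$$ with $\mathcal O(Z)=\infty$ if $P^1_Z\not\ll P^0_Z$. Let $\alpha,\beta\in\mathbb R^d$ be unit vectors with $\alpha'\beta\in(-1,1)$, let $h,m:\mathbb R\to\mathbb R$, and for a unit vector $\gamma$ let $\phi_\gamma(x)=\gamma'x$. Consider two assumptions: * *Assumption 1.* $P^0_X=\mathcal N(0,I_d)$, $m_0(x)=m(\alpha'x)$, $h\ge 0$, $0<\mathbb E_{Z\sim\mathcal N(0,1)}[h(Z)]<\infty$, $P^1_X\ll P^0_X$ and $\frac{dP^1_X}{dP^0_X}(x)=h(\beta'x)/\mathbb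 E_{Z\sim\mathcal N(0,1)}[h(Z)]$. * *Assumption 2.* $P_X=\mathcal N(0,I_d)$, $m_0(x)=m(\alpha'x)$, $0\le h<1$ and $e(x)=h(\beta'x)$. Let $\mathcal D_{\alpha,\beta}$ be the set of all $\gamma=w_1\frac{\alpha+\beta}{\sqrt{2+2\alpha'\beta}}+w_2\frac{\alpha-\beta}{\sqrt{2-2\alpha'\beta}}+n$ with $(1+\alpha'\beta)w_1^2-(1-\alpha'\beta)w_2^2=2\alpha'\beta$, $w_1^2+w_2^2\le1$, $n\perp\alpha,\beta$ and $\|n\|=\sqrt{1-w_1^2-w_2^2}$. Put $s=\operatorname{sign}(\alpha'\beta)$. If $\alpha'\beta\ne0$, then for $\varepsilon\in\{1,-1\}$ the portion of $\mathcal D_{\alpha,\beta}$ with endpoints $\varepsilon\alpha$ and $\varepsilon s\beta$ consists of the $\gamma$ with $\varepsilon w_1>0$ (if $\alpha'\beta>0$) or $\varepsilon w_2>0$ (if $\alpha'\beta<0$); the position of $\gamma$ on it is $t=-\varepsilon w_2$, respectively $t=-\varepsilon w_1$, which increases from $-\sqrt{(1-|\alpha'\beta|)/2}$ at $\varepsilon\alpha$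 to $\sqrt{(1-|\alpha'\beta|)/2}$ at $\varepsilon s\beta$. Fix $C>1$, $0\le\lambda<\frac14$, $0\le\lambda'<\frac{1-4\lambda}{6}$. For an integer $K$ let $\mathcal H^K_{C,\lambda}$ be the set of $K$ times differentiable $h$ with $|h^{(k)}(z)|\le Ce^{\lambda z^2}$ for all $z$ and $k=0,\dots,K$, and let $\mathcal H'^K_{C,\lambda,\lambda'}$ be the set of $K$ times differentiable $h$ with $h(z)\ge0$, $1-h(z)\ge e^{-\lambda'z^2}/C$ for all $z$ and $|h^{(k)}(z)|\le Ce^{\lambda z^2}$ for all $z$ and $k=1,\dots,K$. **Theorem.** 1. If either (a) Assumption 1 holds with $h\in\mathcal H^2_{C,\lambda}$, or (b) Assumption 2 holds with $h\in\mathcal H'^2_{C,\lambda,\lambda'}$, then: * (A) Over unit vectors $\gamma$, $\mathcal O(\phi_\gamma(X))$ is a non-decreasing function of $|\beta'\gamma|$. * (B) If $\alpha'\beta\neq0$, then $\mathcal O(\phi_\gamma(X))$ is a non-decreasing function of the position when moving from $\alpha$ to $s\beta$, and when moving from $-\alpha$ to $-s\beta$, on the corresponding portion of $\mathcal D_{\alpha,\beta}$;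 moreover $\alpha$ and $-\alpha$ are global minimizers of $\gamma\mapsto\mathcal O(\phi_\gamma(X))$ on $\mathcal D_{\alpha,\beta}$. * (C) If $\alpha'\beta=0$, every unit vector $\gamma$ whose orthogonal projection onto $\mathrm{Span}(\alpha,\beta)$ lies in the segment $[-\alpha,\alpha]$ belongs to $\mathcal D_{\alpha,\beta}$ and is a global minimizer of $\gamma\mapsto\mathcal O(\phi_\gamma(X))$ on $\mathcal D_{\alpha,\beta}$. 2. If either (a) Assumption 1 holds with (i) $h\in\mathcal H^{K+1}_{C,\lambda}$ for some integer $K\ge2$ such that $\mathbb E_{Z\sim\mathcal N(0,1)}[h^{(K)}(Z)]\ne0$, or (ii) $h(z)=1_{\{z\le z_0\}}$ for some $z_0\in\mathbb R$, or (iii) $h(z)=\max(0,z)$; or (b) Assumption 2 holds with $h\in\mathcal H'^{K+1}_{C,\lambda,\lambda'}$ for some integer $K\ge2$ such that $\mathbb E_{Z\sim\mathcal N(0,1)}[h^{(K)}(Z)]\ne0$, then (A), (B) and (C) hold with "non-decreasing" replaced by "strictly increasing", with $\pm\alpha$ being the only global minimizers on $\mathcal D_{\alpha,\beta}$ in (B),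 and with the vectors $\gamma$ described in (C) being the only global minimizers on $\mathcal D_{\alpha,\beta}$ in (C). -/

import Mathlib

open MeasureTheory ProbabilityTheory Set
open scoped ENNReal

noncomputable section

/-! ### Treatment groups and the overlap divergence -/

/-- The control distribution `P⁰ = P(· | T = 0)`; treatment is coded by `true`. -/
def controlLaw {Ω : Type*} [MeasurableSpace Ω] (P : Measure Ω) (T : Ω → Bool) : Measure Ω :=
  ProbabilityTheory.cond P (T ⁻¹' {false})

/-- The treated distribution `P¹ = P(· | T = 1)`. -/
def treatedLaw {Ω : Type*} [MeasurableSpace Ω] (P : Measure Ω) (T : Ω → Bool) : Measure Ω :=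
  ProbabilityTheory.cond P (T ⁻¹' {true})

open Classical in
/-- The overlap divergence `𝒪(Z) = E_{P⁰}[(dP¹_Z/dP⁰_Z (Z))²] = χ²(P¹_Z ‖ P⁰_Z) + 1`, with value
`∞` if `P¹_Z` is not absolutely continuous with respect to `P⁰_Z`. -/
def overlapDivergence {Ω S : Type*} [MeasurableSpace Ω] [MeasurableSpace S]
    (P : Measure Ω) (T : Ω → Bool) (Z : Ω → S) : ℝ≥0∞ :=
  if (treatedLaw P T).map Z ≪ (controlLaw P T).map Z then
    ∫⁻ ω, (((treatedLaw P T).map Z).rnDeriv ((controlLaw P T).map Z) (Z ω)) ^ 2 ∂(controlLaw P T)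
  else ∞

/-! ### The two Gaussian / generalized linear model settings -/

/-- First setting: covariates are standard Gaussian in the control group, the control outcome
regression is `m₀(x) = m(α'x)` and the density ratio is
`dP¹_X/dP⁰_X(x) = h(β'x) / E_{Z ∼ N(0,1)}[h(Z)]`. -/
structure GaussianControlGLM {Ω : Type*} [MeasurableSpace Ω] {d : ℕ} (P : Measure Ω)
    (X : Ω → EuclideanSpace ℝ (Fin d)) (T : Ω → Bool) (Y : Ω → ℝ)
    (α β : EuclideanSpace ℝ (Fin d)) (h m : ℝ → ℝ) : Prop where
  norm_α : ‖α‖ = 1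
  norm_β : ‖β‖ = 1
  inner_mem : inner ℝ α β ∈ Ioo (-1 : ℝ) 1
  covariates : (controlLaw P T).map X = stdGaussian (EuclideanSpace ℝ (Fin d))
  outcome : (controlLaw P T)[Y | MeasurableSpace.comap X inferInstance]
    =ᵐ[controlLaw P T] fun ω => m (inner ℝ α (X ω))
  link_nonneg : ∀ z, 0 ≤ h z
  link_integrable : Integrable h (gaussianReal 0 1)
  link_pos : 0 < ∫ z, h z ∂(gaussianReal 0 1)
  overlap : (treatedLaw P T).map X ≪ (controlLaw P T).map X
  density : ((treatedLaw P T).map X).rnDeriv ((controlLaw P T).map X)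
    =ᵐ[(controlLaw P T).map X]
      fun x => ENNReal.ofReal (h (inner ℝ β x) / ∫ z, h z ∂(gaussianReal 0 1))

/-- Second setting: covariates are standard Gaussian in the whole population, the control outcome
regression is `m₀(x) = m(α'x)` and the propensity score `e(X) = P(T = 1 | X)` is `h(β'X)`. -/
structure GaussianPopulationGLM {Ω : Type*} [MeasurableSpace Ω] {d : ℕ} (P : Measure Ω)
    (X : Ω → EuclideanSpace ℝ (Fin d)) (T : Ω → Bool) (Y : Ω → ℝ)
    (α β : EuclideanSpace ℝ (Fin d)) (h m : ℝ → ℝ) : Prop where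
  norm_α : ‖α‖ = 1
  norm_β : ‖β‖ = 1
  inner_mem : inner ℝ α β ∈ Ioo (-1 : ℝ) 1
  covariates : P.map X = stdGaussian (EuclideanSpace ℝ (Fin d))
  outcome : (controlLaw P T)[Y | MeasurableSpace.comap X inferInstance]
    =ᵐ[controlLaw P T] fun ω => m (inner ℝ α (X ω))
  link_nonneg : ∀ z, 0 ≤ h z
  link_lt_one : ∀ z, h z < 1
  propensity : P[fun ω => if T ω = true then (1 : ℝ) else 0 |
      MeasurableSpace.comap X inferInstance]
    =ᵐ[P] fun ω => h (inner ℝ β (X ω))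

/-! ### Classes of link functions -/

/-- `h` is `K` times differentiable (the last derivative need not be continuous). -/
def TimesDifferentiable (K : ℕ) (h : ℝ → ℝ) : Prop :=
  ∀ k < K, Differentiable ℝ (iteratedDeriv k h)

/-- The class `ℋ^K_{C,λ}`. -/
def linkClass (K : ℕ) (C lam : ℝ) : Set (ℝ → ℝ) :=
  {h | TimesDifferentiable K h ∧
    ∀ k ≤ K, ∀ z : ℝ, |iteratedDeriv k h z| ≤ C * Real.exp (lam * z ^ 2)}

/-- The class `ℋ'^K_{C,λ,λ'}`. -/
def propensityLinkClass (K : ℕ) (C lam lam' : ℝ) : Set (ℝ → ℝ) :=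
  {h | TimesDifferentiable K h ∧
    (∀ z : ℝ, Real.exp (-lam' * z ^ 2) / C ≤ 1 - h z ∧ 0 ≤ h z) ∧
    ∀ k, 1 ≤ k → k ≤ K → ∀ z : ℝ, |iteratedDeriv k h z| ≤ C * Real.exp (lam * z ^ 2)}

/-! ### The hyperbola family -/

section Hyperbola

variable {E : Type*} [NormedAddCommGroup E] [InnerProductSpace ℝ E]

/-- `γ` belongs to the hyperbola family with coordinates `w₁, w₂`: it equals
`w₁ (α + β)/√(2 + 2α'β) + w₂ (α - β)/√(2 - 2α'β) + n` with `(w₁, w₂)` on the hyperbola and in the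
unit disc, and `n` orthogonal to `α, β` and completing `γ` to a unit vector. -/
def HyperbolaCoords (α β γ : E) (w₁ w₂ : ℝ) : Prop :=
  (1 + inner ℝ α β) * w₁ ^ 2 - (1 - inner ℝ α β) * w₂ ^ 2 = 2 * inner ℝ α β ∧
  w₁ ^ 2 + w₂ ^ 2 ≤ 1 ∧
  ∃ n ∈ (Submodule.span ℝ {α, β})ᗮ, ‖n‖ = √(1 - w₁ ^ 2 - w₂ ^ 2) ∧
    γ = (w₁ / √(2 + 2 * inner ℝ α β)) • (α + β) + (w₂ / √(2 - 2 * inner ℝ α β)) • (α - β) + n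

/-- The hyperbola family `𝒟_{α,β}`. -/
def hyperbolaFamily (α β : E) : Set E := {γ | ∃ w₁ w₂, HyperbolaCoords α β γ w₁ w₂}

/-- For `α'β ≠ 0` and `ε = ±1`, `γ` lies on the portion of `𝒟_{α,β}` with endpoints `εα` and
`ε sign(α'β) β`, at position `t`. The portion is the one on which `ε w₁ > 0` (if `α'β > 0`) or
`ε w₂ > 0` (if `α'β < 0`); the position is `-ε w₂`, resp. `-ε w₁`, and it increases from
`-√((1 - |α'β|)/2)` at `εα` to `√((1 - |α'β|)/2)` at `ε sign(α'β) β`. -/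
def PortionAt (α β : E) (ε : ℝ) (γ : E) (t : ℝ) : Prop :=
  ∃ w₁ w₂, HyperbolaCoords α β γ w₁ w₂ ∧
    ((0 < inner ℝ α β ∧ 0 < ε * w₁ ∧ t = -(ε * w₂)) ∨
     (inner ℝ α β < 0 ∧ 0 < ε * w₂ ∧ t = -(ε * w₁)))

/-- The global minimizers of `O` on `𝒟_{α,β}`. -/
def familyMinimizers (α β : E) (O : E → ℝ≥0∞) : Set E :=
  {γ | γ ∈ hyperbolaFamily α β ∧ IsMinOn O (hyperbolaFamily α β) γ}

/-- The unit vectors whose orthogonal projection onto `Span(α, β)` lies in `[-α, α]`. -/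
def projectsToSegment [FiniteDimensional ℝ E] (α β : E) : Set E :=
  {γ | ‖γ‖ = 1 ∧ (Submodule.span ℝ {α, β}).starProjection γ ∈ segment ℝ (-α) α}

/-! ### The conclusions, for a function `O` of the (unit) direction `γ` -/

/-- `O(γ)` is a non-decreasing function of `|β'γ|` over unit vectors `γ`. -/
def NondecreasingInAssociation (β : E) (O : E → ℝ≥0∞) : Prop :=
  ∃ g : ℝ → ℝ≥0∞, MonotoneOn g (Icc 0 1) ∧ ∀ γ, ‖γ‖ = 1 → O γ = g |inner ℝ β γ|

/-- `O(γ)` is an increasing function of `|β'γ|` over unit vectors `γ`. -/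
def IncreasingInAssociation (β : E) (O : E → ℝ≥0∞) : Prop :=
  ∃ g : ℝ → ℝ≥0∞, StrictMonoOn g (Icc 0 1) ∧ ∀ γ, ‖γ‖ = 1 → O γ = g |inner ℝ β γ|

/-- `O` is non-decreasing when moving from `α` to `sign(α'β) β`, and from `-α` to
`-sign(α'β) β`, on the corresponding portion of `𝒟_{α,β}`. -/
def NondecreasingAlongFamily (α β : E) (O : E → ℝ≥0∞) : Prop :=
  ∀ ε : ℝ, ε = 1 ∨ ε = -1 → ∃ G : ℝ → ℝ≥0∞,
    MonotoneOn G (Icc (-√((1 - |inner ℝ α β|) / 2)) (√((1 - |inner ℝ α β|) / 2))) ∧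
    (∀ γ t, PortionAt α β ε γ t → O γ = G t) ∧
    PortionAt α β ε (ε • α) (-√((1 - |inner ℝ α β|) / 2)) ∧
    PortionAt α β ε ((ε * SignType.sign (inner ℝ α β)) • β) (√((1 - |inner ℝ α β|) / 2))

/-- The same with "increasing". -/
def IncreasingAlongFamily (α β : E) (O : E → ℝ≥0∞) : Prop :=
  ∀ ε : ℝ, ε = 1 ∨ ε = -1 → ∃ G : ℝ → ℝ≥0∞,
    StrictMonoOn G (Icc (-√((1 - |inner ℝ α β|) / 2)) (√((1 - |inner ℝ α β|) / 2))) ∧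
    (∀ γ t, PortionAt α β ε γ t → O γ = G t) ∧
    PortionAt α β ε (ε • α) (-√((1 - |inner ℝ α β|) / 2)) ∧
    PortionAt α β ε ((ε * SignType.sign (inner ℝ α β)) • β) (√((1 - |inner ℝ α β|) / 2))

end Hyperbola

end

/-! Everything reduces to one function of a correlation. For unit γ, the pair (γ'x, β'x) is Gaussian
with correlation r = β'γ, so projecting a density h(β'x) along γ yields the density M_r h, where M_r
h(u) = E[h(ru + √(1 - r²) Z)] is the Mehler operator (`stdGaussian_withDensity_map_inner`). Hence
the overlap divergence is c ∫ ψ(M_r h) dN(0,1) with c > 0, where ψ(q) = q² in the first setting and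
ψ(q) = q²/(1 - q) in the second.

Both ψ are strictly convex. For 0 ≤ r < t ≤ 1 the semigroup law `mehler_mul` gives M_r h = M_s (M_t
h) with s = r/t < 1. Conditional Jensen and the invariance of N(0,1) under M_s show that the
integral does not decrease from r to t. Reflection symmetry of the Gaussian makes it depend on |r|
only. No Hermite expansion or differentiation in r is needed.

Equality at r < t forces M_t h to be a.e. constant, because N(su, 1 - s²) and N(0,1) have the same
null sets. Since t ≠ 0, a Fourier argument (`ae_const_of_mehler_ae_const`) makes h itself a.e.
constant, which the links of the strict part are not.

The geometric claims follow from the identity (α'γ)(β'γ) = α'β on the hyperbola family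
(`HyperbolaCoords.inner_mul_inner`). It gives |β'γ| ≥ |α'β|. If α'β ≠ 0, equality means |α'γ| = 1,
that is γ = ±α; if α'β = 0, it means β'γ = 0. Along a portion, |β'γ| is an explicit strictly
increasing function of the position (`PortionAt.abs_inner`, `portion_profile`). -/

/-! ### Gaussian laws on the line and on the plane -/

section GaussianLaws

local notation "γ₁" => gaussianReal 0 1

/-- Cramér–Wold device in the plane. -/
theorem Measure.ext_of_map_linear_combination {μ ν : Measure (ℝ × ℝ)} [IsFiniteMeasure μ]
    [IsFiniteMeasure ν]
    (H : ∀ a b : ℝ, μ.map (fun p => a * p.1 + b * p.2) = ν.map (fun p => a * p.1 + b * p.2)) :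
    μ = ν := by
  refine Measure.ext_of_charFunDual (funext fun L => ?_)
  rw [charFunDual_eq_charFun_map_one, charFunDual_eq_charFun_map_one]
  have hL : (L : ℝ × ℝ → ℝ) = fun p => L (1, 0) * p.1 + L (0, 1) * p.2 := by
    ext p
    have : p = p.1 • ((1, 0) : ℝ × ℝ) + p.2 • ((0, 1) : ℝ × ℝ) := by ext <;> simp
    conv_lhs => rw [this, map_add, map_smul, map_smul]
    simp [mul_comm]
  rw [hL, H]

theorem gaussianReal_prod_map_linear (a b : ℝ) :
    ((γ₁).prod γ₁).map (fun p : ℝ × ℝ => a * p.1 + b * p.2)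
      = gaussianReal 0 (a ^ 2 + b ^ 2).toNNReal := by
  have hind : IndepFun (fun p : ℝ × ℝ => a * p.1) (fun p => b * p.2) ((γ₁).prod γ₁) :=
    indepFun_prod (X := fun x : ℝ => a * x) (Y := fun x : ℝ => b * x) (by fun_prop) (by fun_prop)
  have h1 : ((γ₁).prod γ₁).map (fun p : ℝ × ℝ => a * p.1)
      = gaussianReal (a * 0) (NNReal.mk (a ^ 2) (sq_nonneg a) * 1) := by
    have e : ((γ₁).prod γ₁).map Prod.fst = γ₁ := measurePreserving_fst.map_eq
    rw [← gaussianReal_map_const_mul]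
    conv_rhs => rw [← e, Measure.map_map (by fun_prop) (by fun_prop)]
    rfl
  have h2 : ((γ₁).prod γ₁).map (fun p : ℝ × ℝ => b * p.2)
      = gaussianReal (b * 0) (NNReal.mk (b ^ 2) (sq_nonneg b) * 1) := by
    have e : ((γ₁).prod γ₁).map Prod.snd = γ₁ := measurePreserving_snd.map_eq
    rw [← gaussianReal_map_const_mul]
    conv_rhs => rw [← e, Measure.map_map (by fun_prop) (by fun_prop)]
    rfl
  have := gaussianReal_add_gaussianReal_of_indepFun hind h1 h2
  change ((γ₁).prod γ₁).map ((fun p : ℝ × ℝ => a * p.1) + fun p => b * p.2) = _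
  rw [this]
  congr 1
  · simp
  · ext
    simp [Real.coe_toNNReal _ (add_nonneg (sq_nonneg a) (sq_nonneg b))]

theorem stdGaussian_map_inner {E : Type*} [NormedAddCommGroup E] [InnerProductSpace ℝ E]
    [FiniteDimensional ℝ E] [MeasurableSpace E] [BorelSpace E] (v : E) :
    (stdGaussian E).map (fun x => inner ℝ v x) = gaussianReal 0 (‖v‖ ^ 2).toNNReal := by
  have h := IsGaussian.map_eq_gaussianReal (μ := stdGaussian E) (innerSL ℝ v)
  rw [variance_dual_stdGaussian, integral_strongDual_stdGaussian, innerSL_apply_norm] at h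
  exact h

theorem one_sub_sq_nonneg {r : ℝ} (hr : |r| ≤ 1) : 0 ≤ 1 - r ^ 2 := by
  have := (sq_le_one_iff_abs_le_one r).2 hr
  linarith

/-- A pair of standard normal variables with correlation `r`, built from two independent ones. -/
noncomputable def correlate (r : ℝ) (p : ℝ × ℝ) : ℝ × ℝ := (p.1, r * p.1 + √(1 - r ^ 2) * p.2)

@[fun_prop]
theorem measurable_correlate (r : ℝ) : Measurable (correlate r) := by
  unfold correlate; fun_prop

theorem map_correlate_linear {r : ℝ} (hr : |r| ≤ 1) (a b : ℝ) :
    (((γ₁).prod γ₁).map (correlate r)).map (fun p => a * p.1 + b * p.2)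
      = gaussianReal 0 (a ^ 2 + 2 * r * (a * b) + b ^ 2).toNNReal := by
  rw [Measure.map_map (by fun_prop) (by fun_prop)]
  have h : (fun p : ℝ × ℝ => a * p.1 + b * p.2) ∘ correlate r
      = fun p => (a + b * r) * p.1 + (b * √(1 - r ^ 2)) * p.2 := by
    ext p; simp only [correlate, Function.comp]; ring
  rw [h, gaussianReal_prod_map_linear]
  congr 2
  rw [mul_pow, Real.sq_sqrt (one_sub_sq_nonneg hr)]
  ring

instance (r : ℝ) : IsProbabilityMeasure (((γ₁).prod γ₁).map (correlate r)) :=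
  Measure.isProbabilityMeasure_map (by fun_prop)

/-- The variance a² + 2rab + b² of a linear combination is symmetric in (a, b). This exchangeability
is the self-adjointness of the Mehler operator. -/
theorem map_correlate_swap {r : ℝ} (hr : |r| ≤ 1) :
    (((γ₁).prod γ₁).map (correlate r)).map Prod.swap = ((γ₁).prod γ₁).map (correlate r) := by
  have : IsProbabilityMeasure ((((γ₁).prod γ₁).map (correlate r)).map Prod.swap) :=
    Measure.isProbabilityMeasure_map (by fun_prop)
  refine Measure.ext_of_map_linear_combination fun a b => ?_
  rw [map_correlate_linear hr, Measure.map_map (by fun_prop) (by fun_prop)]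
  have h : (fun p : ℝ × ℝ => a * p.1 + b * p.2) ∘ Prod.swap = fun p => b * p.1 + a * p.2 := by
    ext p; simp only [Function.comp, Prod.swap]; ring
  rw [h, map_correlate_linear hr]
  congr 2
  ring

theorem stdGaussian_map_inner_pair {E : Type*} [NormedAddCommGroup E] [InnerProductSpace ℝ E]
    [FiniteDimensional ℝ E] [MeasurableSpace E] [BorelSpace E] {v w : E}
    (hv : ‖v‖ = 1) (hw : ‖w‖ = 1) :
    (stdGaussian E).map (fun x => (inner ℝ v x, inner ℝ w x))
      = ((γ₁).prod γ₁).map (correlate (inner ℝ w v)) := by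
  have hr : |inner ℝ w v| ≤ 1 := by simpa [hv, hw] using abs_real_inner_le_norm w v
  have : IsProbabilityMeasure
      ((stdGaussian E).map (fun x => ((inner ℝ v x : ℝ), (inner ℝ w x : ℝ)))) :=
    Measure.isProbabilityMeasure_map (by fun_prop)
  refine Measure.ext_of_map_linear_combination fun a b => ?_
  rw [map_correlate_linear hr, Measure.map_map (by fun_prop) (by fun_prop)]
  have h : (fun p : ℝ × ℝ => a * p.1 + b * p.2) ∘ (fun x => ((inner ℝ v x : ℝ), (inner ℝ w x : ℝ)))
      = fun x => inner ℝ (a • v + b • w) x := by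
    ext x; simp [inner_add_left, real_inner_smul_left]
  rw [h, stdGaussian_map_inner]
  congr 2
  rw [norm_add_sq_real, norm_smul, norm_smul, hv, hw, real_inner_smul_left, real_inner_smul_right,
    real_inner_comm, mul_one, mul_one, Real.norm_eq_abs, Real.norm_eq_abs, sq_abs, sq_abs]
  ring

/-- Stationarity of N(0,1), from r² + (1 - r²) = 1. It transfers integrability and almost sure
statements about h to almost every fibre of the Mehler integral. -/
theorem measurePreserving_snd_correlate {r : ℝ} (hr : |r| ≤ 1) :
    MeasurePreserving (fun p : ℝ × ℝ => r * p.1 + √(1 - r ^ 2) * p.2) ((γ₁).prod γ₁) γ₁ := by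
  refine ⟨by fun_prop, ?_⟩
  rw [gaussianReal_prod_map_linear, Real.sq_sqrt (one_sub_sq_nonneg hr)]
  simp

end GaussianLaws

/-! ### The Mehler operator -/

section Mehler

local notation "γ₁" => gaussianReal 0 1

/-- The Mehler (Ornstein–Uhlenbeck) operator `h ↦ E[h(r u + √(1 - r²) Z)]`, `Z ∼ N(0, 1)`. -/
noncomputable def mehler (r : ℝ) (h : ℝ → ℝ) (u : ℝ) : ℝ :=
  ∫ z, h (r * u + √(1 - r ^ 2) * z) ∂γ₁

theorem mehler_neg (r : ℝ) (h : ℝ → ℝ) (u : ℝ) : mehler (-r) h u = mehler r h (-u) := by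
  simp [mehler]

theorem stronglyMeasurable_mehler (r : ℝ) {h : ℝ → ℝ} (hm : Measurable h) :
    StronglyMeasurable (mehler r h) := by
  have : Measurable (Function.uncurry fun u z : ℝ => h (r * u + √(1 - r ^ 2) * z)) :=
    hm.comp (by fun_prop)
  exact this.stronglyMeasurable.integral_prod_right

theorem integrable_correlate {r : ℝ} (hr : |r| ≤ 1) {h : ℝ → ℝ} (hi : Integrable h γ₁) :
    Integrable (fun p : ℝ × ℝ => h (r * p.1 + √(1 - r ^ 2) * p.2)) ((γ₁).prod γ₁) :=
  ((measurePreserving_snd_correlate hr).integrable_comp hi.1).2 hi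

theorem ae_integrable_mehler {r : ℝ} (hr : |r| ≤ 1) {h : ℝ → ℝ} (hi : Integrable h γ₁) :
    ∀ᵐ u ∂γ₁, Integrable (fun z => h (r * u + √(1 - r ^ 2) * z)) γ₁ :=
  (integrable_correlate hr hi).prod_right_ae

theorem integrable_mehler {r : ℝ} (hr : |r| ≤ 1) {h : ℝ → ℝ} (hi : Integrable h γ₁) :
    Integrable (mehler r h) γ₁ :=
  (integrable_correlate hr hi).integral_prod_left

theorem integral_mehler {r : ℝ} (hr : |r| ≤ 1) {h : ℝ → ℝ} (hi : Integrable h γ₁) :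
    ∫ u, mehler r h u ∂γ₁ = ∫ u, h u ∂γ₁ := by
  have h1 := integral_prod _ (integrable_correlate hr hi)
  have hm := measurePreserving_snd_correlate hr
  have h2 := integral_map hm.measurable.aemeasurable (f := h) (by rw [hm.map_eq]; exact hi.1)
  rw [hm.map_eq] at h2
  rw [h2, h1]
  rfl

/-- Two successive noises, of variances t²(1 - s²) and 1 - t², add up to one of variance 1 - (st)².
The identity is only almost everywhere since Fubini needs h integrable on the fibre over u. -/
theorem mehler_mul {s t : ℝ} (hs : |s| ≤ 1) (ht : |t| ≤ 1) {h : ℝ → ℝ} (hm : Measurable h)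
    (hi : Integrable h γ₁) :
    mehler (s * t) h =ᵐ[γ₁] mehler s (mehler t h) := by
  have hst : |s * t| ≤ 1 := by
    rw [abs_mul]; exact mul_le_one₀ hs (abs_nonneg _) ht
  filter_upwards [ae_integrable_mehler hst hi] with u hu
  have hlaw : ((γ₁).prod γ₁).map (fun p : ℝ × ℝ => (t * √(1 - s ^ 2)) * p.1 + √(1 - t ^ 2) * p.2)
      = (γ₁).map (fun z => √(1 - (s * t) ^ 2) * z) := by
    rw [gaussianReal_prod_map_linear, gaussianReal_map_const_mul]
    congr 1
    · simp
    · ext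
      rw [Real.coe_toNNReal _ (by positivity)]
      simp only [mul_one, NNReal.coe_mk]
      rw [mul_pow, Real.sq_sqrt (one_sub_sq_nonneg hs), Real.sq_sqrt (one_sub_sq_nonneg ht),
        Real.sq_sqrt (one_sub_sq_nonneg hst)]
      ring
  have hm' : Measurable fun y => h (s * t * u + y) := hm.comp (by fun_prop)
  have hi' : Integrable (fun y => h (s * t * u + y))
      ((γ₁).map (fun z => √(1 - (s * t) ^ 2) * z)) :=
    (integrable_map_measure hm'.aestronglyMeasurable (by fun_prop)).2 hu
  have h1 : mehler (s * t) h u = ∫ y, h (s * t * u + y) ∂((γ₁).map (fun z => √(1 - (s * t) ^ 2) * z)) :=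
    (integral_map (by fun_prop) hm'.aestronglyMeasurable).symm
  rw [← hlaw] at hi' h1
  rw [h1, integral_map (by fun_prop) hm'.aestronglyMeasurable]
  refine (integral_prod _
    ((integrable_map_measure hm'.aestronglyMeasurable (by fun_prop)).1 hi')).trans ?_
  refine integral_congr_ae (Filter.Eventually.of_forall fun z =>
    integral_congr_ae (Filter.Eventually.of_forall fun w => ?_))
  simp only [Function.comp]
  congr 1
  ring

/-- Both sides compute E[h(W) exp(itU)] for a standard pair (U, W) of correlation r. Conditioning on
U gives the left side; by exchangeability U may be written rW + √(1 - r²) Z with Z independent of W,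
and the exponential factors. -/
theorem integral_correlate_mul_exp {r : ℝ} (hr : |r| ≤ 1) {h : ℝ → ℝ} (hi : Integrable h γ₁)
    (t : ℝ) :
    ∫ u, (mehler r h u : ℂ) * Complex.exp (t * u * Complex.I) ∂γ₁
      = (∫ w, (h w : ℂ) * Complex.exp ((r * t : ℝ) * w * Complex.I) ∂γ₁)
        * charFun γ₁ (t * √(1 - r ^ 2)) := by
  have hexp : ∀ x y : ℝ, ‖Complex.exp (x * y * Complex.I)‖ = 1 := fun x y => by
    rw [← Complex.ofReal_mul]; exact Complex.norm_exp_ofReal_mul_I _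
  let F : ℝ × ℝ → ℂ := fun p => (h p.2 : ℂ) * Complex.exp (t * p.1 * Complex.I)
  have hcont : Continuous fun p : ℝ × ℝ => Complex.exp (t * p.1 * Complex.I) := by fun_prop
  have hF : Integrable F (((γ₁).prod γ₁).map (correlate r)) := by
    have hsnd : Integrable (fun p : ℝ × ℝ => h p.2) (((γ₁).prod γ₁).map (correlate r)) := by
      have hmp : MeasurePreserving Prod.snd (((γ₁).prod γ₁).map (correlate r)) γ₁ := by
        refine ⟨measurable_snd, ?_⟩
        rw [Measure.map_map measurable_snd (by fun_prop)]
        exact (measurePreserving_snd_correlate hr).map_eq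
      exact (hmp.integrable_comp hi.1).2 hi
    refine hsnd.ofReal.mul_bdd (c := 1) hcont.aestronglyMeasurable ?_
    exact Filter.Eventually.of_forall fun p => (hexp _ _).le
  have hFc : Integrable (F ∘ correlate r) ((γ₁).prod γ₁) :=
    (integrable_map_measure hF.1 (by fun_prop)).1 hF
  have h1 : ∫ p, F p ∂(((γ₁).prod γ₁).map (correlate r))
      = ∫ u, (mehler r h u : ℂ) * Complex.exp (t * u * Complex.I) ∂γ₁ := by
    rw [integral_map (by fun_prop) hF.1]
    refine (integral_prod _ hFc).trans (integral_congr_ae (Filter.Eventually.of_forall fun u => ?_))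
    simp only [F, Function.comp, correlate]
    rw [integral_mul_const, integral_complex_ofReal]
    rfl
  have hsw : Integrable (F ∘ Prod.swap) (((γ₁).prod γ₁).map (correlate r)) := by
    rw [← map_correlate_swap hr] at hF
    exact (integrable_map_measure hF.1 (by fun_prop)).1 hF
  have hswc : Integrable ((F ∘ Prod.swap) ∘ correlate r) ((γ₁).prod γ₁) :=
    (integrable_map_measure hsw.1 (by fun_prop)).1 hsw
  rw [← h1]
  conv_lhs => rw [← map_correlate_swap hr]
  rw [integral_map (by fun_prop) (by rw [map_correlate_swap hr]; exact hF.1)]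
  refine (integral_map (f := F ∘ Prod.swap) (by fun_prop) hsw.1).trans ?_
  refine (integral_prod _ hswc).trans ?_
  rw [← integral_mul_const]
  refine integral_congr_ae (Filter.Eventually.of_forall fun w => ?_)
  simp only [F, Function.comp, correlate, Prod.swap, charFun_apply_real]
  rw [mul_assoc, ← integral_const_mul, ← integral_const_mul]
  congr 1 with z
  rw [← Complex.exp_add]
  push_cast
  ring_nf

/-- The Mehler operator is injective on nonnegative functions, at constants. -/
theorem ae_const_of_mehler_ae_const {r : ℝ} (hr : |r| ≤ 1) (h0 : r ≠ 0) {h : ℝ → ℝ}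
    (hn : ∀ z, 0 ≤ h z) (hm : Measurable h) (hi : Integrable h γ₁) {c : ℝ} (hc : 0 ≤ c)
    (H : mehler r h =ᵐ[γ₁] fun _ => c) : h =ᵐ[γ₁] fun _ => c := by
  have key : ∀ (f : ℝ → ℝ), (∀ z, 0 ≤ f z) → Measurable f → ∀ τ : ℝ,
      charFun ((γ₁).withDensity fun z => ENNReal.ofReal (f z)) τ
        = ∫ w, (f w : ℂ) * Complex.exp (τ * w * Complex.I) ∂γ₁ := by
    intro f hf hfm τ
    rw [charFun_apply_real, integral_withDensity_eq_integral_toReal_smul (by fun_prop) (by simp)]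
    simp [ENNReal.toReal_ofReal (hf _)]
  have hfin : ∀ f : ℝ → ℝ, Integrable f γ₁ →
      IsFiniteMeasure ((γ₁).withDensity fun z => ENNReal.ofReal (f z)) := fun f hf =>
    isFiniteMeasure_withDensity_ofReal hf.2
  have := hfin h hi
  have := hfin (fun _ => c) (integrable_const c)
  -- Nonnegativity turns h and c into densities of finite measures, which their characteristic
  -- functions determine.
  have heq : ((γ₁).withDensity fun z => ENNReal.ofReal (h z))
      = (γ₁).withDensity fun _ => ENNReal.ofReal c := by
    refine Measure.ext_of_charFun (funext fun τ => ?_)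
    rw [key h hn hm, key (fun _ => c) (fun _ => hc) measurable_const]
    -- Frequency τ/r on the Mehler side corresponds to frequency τ for h; the Gaussian factor common
    -- to both identities never vanishes and cancels.
    have e1 := integral_correlate_mul_exp hr hi (τ / r)
    have e2 := integral_correlate_mul_exp hr (integrable_const (μ := γ₁) c) (τ / r)
    rw [mul_div_cancel₀ _ h0] at e1 e2
    have e3 : ∫ u, (mehler r h u : ℂ) * Complex.exp ((τ / r : ℝ) * u * Complex.I) ∂γ₁
        = ∫ u, (mehler r (fun _ => c) u : ℂ) * Complex.exp ((τ / r : ℝ) * u * Complex.I) ∂γ₁ := by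
      refine integral_congr_ae ?_
      filter_upwards [H] with u hu
      rw [hu]
      simp [mehler]
    rw [e1, e2] at e3
    refine mul_right_cancel₀ ?_ e3
    rw [charFun_gaussianReal]
    exact Complex.exp_ne_zero _
  rw [withDensity_eq_iff (by fun_prop) (by fun_prop)] at heq
  · filter_upwards [heq] with z hz
    exact (ENNReal.ofReal_eq_ofReal_iff (hn z) hc).1 hz
  · exact hi.lintegral_lt_top.ne

end Mehler

/-! ### Strict Jensen inequality and monotonicity of convex functionals of the Mehler operator -/

section Jensen

local notation "γ₁" => gaussianReal 0 1

/-- `ψ` is a nonnegative measurable function on `S` with strict supporting lines of slope `ψ'`, and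
`S` is stable under averages. -/
structure StrictSupport (S : Set ℝ) (ψ ψ' : ℝ → ℝ) : Prop where
  lt : ∀ x ∈ S, ∀ a ∈ S, x ≠ a → ψ a + ψ' a * (x - a) < ψ x
  nonneg : ∀ x ∈ S, 0 ≤ ψ x
  measurable : Measurable ψ
  mean_mem : ∀ (μ : Measure ℝ) [IsProbabilityMeasure μ] (g : ℝ → ℝ), Integrable g μ →
    (∀ᵐ x ∂μ, g x ∈ S) → ∫ x, g x ∂μ ∈ S

theorem strictSupport_sq : StrictSupport univ (fun q => q ^ 2) (fun q => 2 * q) where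
  lt x _ a _ hxa := by
    have : 0 < (x - a) ^ 2 := by have := sub_ne_zero.2 hxa; positivity
    nlinarith
  nonneg x _ := sq_nonneg x
  measurable := by fun_prop
  mean_mem _ _ _ _ _ := mem_univ _

/-- Since q²/(1 - q) = 1/(1 - q) - 1 - q, the slope is 1/(1 - q)² - 1, and the gap above the tangent
at a is (x - a)²/((1 - x)(1 - a)²). -/
theorem strictSupport_sq_div : StrictSupport (Iio 1) (fun q => q ^ 2 / (1 - q))
    (fun q => 1 / (1 - q) ^ 2 - 1) where
  lt x hx a ha hxa := by
    have h1 : 0 < 1 - x := sub_pos.2 hx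
    have h2 : 0 < 1 - a := sub_pos.2 ha
    have h3 := sub_ne_zero.2 hxa
    have : x ^ 2 / (1 - x) - (a ^ 2 / (1 - a) + (1 / (1 - a) ^ 2 - 1) * (x - a))
        = (x - a) ^ 2 / ((1 - x) * (1 - a) ^ 2) := by
      field_simp
      ring
    have h4 : 0 < (x - a) ^ 2 / ((1 - x) * (1 - a) ^ 2) := by positivity
    linarith
  nonneg x hx := div_nonneg (sq_nonneg x) (sub_nonneg.2 (le_of_lt hx))
  measurable := by fun_prop
  mean_mem μ _ g hg hS := by
    have hint : Integrable (fun x => 1 - g x) μ := (integrable_const 1).sub hg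
    have hnn : 0 ≤ᵐ[μ] fun x => 1 - g x := by
      filter_upwards [hS] with x hx using sub_nonneg.2 (le_of_lt hx)
    -- The mean stays strictly below 1: a zero integral of 1 - g ≥ 0 would make g = 1 almost
    -- everywhere.
    have h0 : 0 < ∫ x, (1 - g x) ∂μ := by
      refine lt_of_le_of_ne (integral_nonneg_of_ae hnn) fun h => ?_
      have hz := (integral_eq_zero_iff_of_nonneg_ae hnn hint).1 h.symm
      obtain ⟨x, hx, hx'⟩ := (hz.and hS).exists
      exact (sub_pos.2 (mem_Iio.1 hx')).ne' hx
    rw [integral_sub (integrable_const 1) hg] at h0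
    simpa using h0

variable {S : Set ℝ} {ψ ψ' : ℝ → ℝ}

theorem StrictSupport.le (H : StrictSupport S ψ ψ') {x a : ℝ} (hx : x ∈ S) (ha : a ∈ S) :
    ψ a + ψ' a * (x - a) ≤ ψ x := by
  by_cases h : x = a
  · simp [h]
  · exact (H.lt x hx a ha h).le

/-- Integrate the supporting line at the mean: its linear part vanishes. In the equality case the
nonnegative gap has integral zero, and strictness of the line leaves only g equal to its mean. -/
theorem StrictSupport.jensen (H : StrictSupport S ψ ψ') {μ : Measure ℝ} [IsProbabilityMeasure μ]
    {g : ℝ → ℝ} (hg : Integrable g μ) (hS : ∀ᵐ x ∂μ, g x ∈ S)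
    (hψ : Integrable (fun x => ψ (g x)) μ) :
    ψ (∫ x, g x ∂μ) ≤ ∫ x, ψ (g x) ∂μ ∧
      (ψ (∫ x, g x ∂μ) = ∫ x, ψ (g x) ∂μ → ∀ᵐ x ∂μ, g x = ∫ y, g y ∂μ) := by
  set a := ∫ x, g x ∂μ with ha
  have haS : a ∈ S := H.mean_mem μ g hg hS
  have hlin : Integrable (fun x => ψ' a * (g x - a)) μ := (hg.sub (integrable_const a)).const_mul _
  have hlin' : Integrable (fun x => ψ a + ψ' a * (g x - a)) μ := (integrable_const _).add hlin
  have hD : Integrable (fun x => ψ (g x) - (ψ a + ψ' a * (g x - a))) μ := hψ.sub hlin'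
  have hnn : 0 ≤ᵐ[μ] fun x => ψ (g x) - (ψ a + ψ' a * (g x - a)) := by
    filter_upwards [hS] with x hx
    exact sub_nonneg.2 (H.le hx haS)
  have hval : ∫ x, (ψ (g x) - (ψ a + ψ' a * (g x - a))) ∂μ = ∫ x, ψ (g x) ∂μ - ψ a := by
    rw [integral_sub hψ hlin', integral_add (integrable_const _) hlin, integral_const_mul,
      integral_sub hg (integrable_const a), ← ha]
    simp
  refine ⟨?_, fun heq => ?_⟩
  · have := integral_nonneg_of_ae hnn
    rw [hval] at this
    linarith
  · rw [sub_eq_zero.2 heq.symm, integral_eq_zero_iff_of_nonneg_ae hnn hD] at hval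
    filter_upwards [hval, hS] with x hx hxS
    by_contra hne
    have := H.lt _ hxS _ haS hne
    simp only [Pi.zero_apply] at hx
    linarith

theorem StrictSupport.ae_mehler (H : StrictSupport S ψ ψ') {g : ℝ → ℝ} (hg : Integrable g γ₁)
    (hS : ∀ᵐ x ∂γ₁, g x ∈ S) (hψ : Integrable (fun x => ψ (g x)) γ₁) {s : ℝ} (hs : |s| ≤ 1) :
    ∀ᵐ u ∂γ₁, mehler s g u ∈ S ∧ ψ (mehler s g u) ≤ mehler s (fun x => ψ (g x)) u ∧
      (ψ (mehler s g u) = mehler s (fun x => ψ (g x)) u →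
        ∀ᵐ z ∂γ₁, g (s * u + √(1 - s ^ 2) * z) = mehler s g u) := by
  have hS2 : ∀ᵐ p ∂((γ₁).prod γ₁), g (s * p.1 + √(1 - s ^ 2) * p.2) ∈ S :=
    (measurePreserving_snd_correlate hs).quasiMeasurePreserving.ae hS
  filter_upwards [ae_integrable_mehler hs hg, ae_integrable_mehler hs hψ,
    Measure.ae_ae_of_ae_prod hS2] with u h1 h2 h3
  exact ⟨H.mean_mem γ₁ _ h1 h3, H.jensen h1 h3 h2⟩

theorem StrictSupport.integrable_mehler (H : StrictSupport S ψ ψ') {g : ℝ → ℝ} (hm : Measurable g)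
    (hg : Integrable g γ₁) (hS : ∀ᵐ x ∂γ₁, g x ∈ S) (hψ : Integrable (fun x => ψ (g x)) γ₁)
    {s : ℝ} (hs : |s| ≤ 1) : Integrable (fun u => ψ (mehler s g u)) γ₁ := by
  refine (_root_.integrable_mehler hs hψ).mono'
    (H.measurable.comp (stronglyMeasurable_mehler s hm).measurable).aestronglyMeasurable ?_
  filter_upwards [H.ae_mehler hg hS hψ hs] with u hu
  rw [Real.norm_of_nonneg (H.nonneg _ hu.1)]
  exact hu.2.1

/-- Fibrewise Jensen bounds ψ(M_s g) by M_s(ψ ∘ g), whose Gaussian integral is that of ψ ∘ g by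
stationarity. -/
theorem StrictSupport.integral_mehler_le (H : StrictSupport S ψ ψ') {g : ℝ → ℝ} (hm : Measurable g)
    (hg : Integrable g γ₁) (hS : ∀ᵐ x ∂γ₁, g x ∈ S) (hψ : Integrable (fun x => ψ (g x)) γ₁)
    {s : ℝ} (hs : |s| ≤ 1) : ∫ u, ψ (mehler s g u) ∂γ₁ ≤ ∫ u, ψ (g u) ∂γ₁ := by
  rw [← integral_mehler hs hψ]
  refine integral_mono_ae (H.integrable_mehler hm hg hS hψ hs) (_root_.integrable_mehler hs hψ) ?_
  filter_upwards [H.ae_mehler hg hS hψ hs] with u hu using hu.2.1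

/-- Equality in the contraction property of the Mehler operator forces a constant. -/
theorem StrictSupport.ae_const_of_integral_mehler_eq (H : StrictSupport S ψ ψ') {g : ℝ → ℝ}
    (hm : Measurable g) (hg : Integrable g γ₁) (hS : ∀ᵐ x ∂γ₁, g x ∈ S)
    (hψ : Integrable (fun x => ψ (g x)) γ₁) {s : ℝ} (hs : |s| < 1)
    (heq : ∫ u, ψ (mehler s g u) ∂γ₁ = ∫ u, ψ (g u) ∂γ₁) : ∃ c, g =ᵐ[γ₁] fun _ => c := by
  rw [← integral_mehler hs.le hψ] at heq
  have hle : (fun u => ψ (mehler s g u)) ≤ᵐ[γ₁] mehler s (fun x => ψ (g x)) := by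
    filter_upwards [H.ae_mehler hg hS hψ hs.le] with u hu using hu.2.1
  have hae := (integral_eq_iff_of_ae_le (H.integrable_mehler hm hg hS hψ hs.le)
    (_root_.integrable_mehler hs.le hψ) hle).1 heq
  -- A single u with equality in Jensen suffices: g is then constant a.e. under N(su, 1 - s²), which
  -- for |s| < 1 is nondegenerate and so has the null sets of N(0,1).
  obtain ⟨u, hu, hu'⟩ := (hae.and (H.ae_mehler hg hS hψ hs.le)).exists
  refine ⟨mehler s g u, ?_⟩
  have hz := hu'.2.2 hu
  set σ := √(1 - s ^ 2) with hσ
  have hσ0 : 0 < σ := Real.sqrt_pos.2 (by have := (sq_lt_one_iff_abs_lt_one s).2 hs; linarith)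
  have hlaw : (γ₁).map (fun z => s * u + σ * z)
      = gaussianReal (s * u) (NNReal.mk (σ ^ 2) (sq_nonneg _)) := by
    have : (fun z => s * u + σ * z) = (fun y => s * u + y) ∘ fun z => σ * z := rfl
    rw [this, ← Measure.map_map (by fun_prop) (by fun_prop), gaussianReal_map_const_mul,
      gaussianReal_map_const_add]
    simp
  have hne : NNReal.mk (σ ^ 2) (sq_nonneg _) ≠ 0 := by
    intro h0
    have := congrArg NNReal.toReal h0
    simp only [NNReal.coe_mk, NNReal.coe_zero] at this
    exact (pow_pos hσ0 2).ne' this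
  have hset : MeasurableSet {y | g y = mehler s g u} := hm (measurableSet_singleton _)
  have h1 : ∀ᵐ y ∂(gaussianReal (s * u) (NNReal.mk (σ ^ 2) (sq_nonneg _))), g y = mehler s g u := by
    rw [← hlaw, ae_map_iff (by fun_prop) hset]
    exact hz
  exact (gaussianReal_absolutelyContinuous 0 one_ne_zero).ae_le
    ((gaussianReal_absolutelyContinuous' _ hne).ae_le h1)

variable {h : ℝ → ℝ}

/-- For r < t write M_r h = M_{r/t}(M_t h) and apply the contraction property to g = M_t h. -/
theorem StrictSupport.monotoneOn_mehler (H : StrictSupport S ψ ψ') (hm : Measurable h)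
    (hi : Integrable h γ₁) (hS : ∀ᵐ x ∂γ₁, h x ∈ S) (hψ : Integrable (fun x => ψ (h x)) γ₁) :
    MonotoneOn (fun r => ∫ u, ψ (mehler r h u) ∂γ₁) (Icc 0 1) := by
  intro r hr t ht hrt
  rcases eq_or_lt_of_le hrt with rfl | hlt
  · exact le_rfl
  have ht0 : 0 < t := hr.1.trans_lt hlt
  have ht1 : |t| ≤ 1 := abs_le.2 ⟨by linarith [ht.1], ht.2⟩
  have hs : |r / t| < 1 := by
    rw [abs_of_nonneg (div_nonneg hr.1 ht0.le), div_lt_one ht0]; exact hlt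
  have hmul := mehler_mul hs.le ht1 hm hi
  rw [div_mul_cancel₀ _ ht0.ne'] at hmul
  have hc : ∫ u, ψ (mehler r h u) ∂γ₁ = ∫ u, ψ (mehler (r / t) (mehler t h) u) ∂γ₁ :=
    integral_congr_ae (by filter_upwards [hmul] with u hu; rw [hu])
  simp only
  rw [hc]
  exact H.integral_mehler_le (stronglyMeasurable_mehler t hm).measurable
    (_root_.integrable_mehler ht1 hi)
    (by filter_upwards [H.ae_mehler hi hS hψ ht1] with u hu using hu.1)
    (H.integrable_mehler hm hi hS hψ ht1) hs.le

theorem StrictSupport.strictMonoOn_mehler (H : StrictSupport S ψ ψ') (hm : Measurable h)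
    (hn : ∀ z, 0 ≤ h z)
    (hi : Integrable h γ₁) (hS : ∀ᵐ x ∂γ₁, h x ∈ S) (hψ : Integrable (fun x => ψ (h x)) γ₁)
    (hconst : ¬ ∃ c, h =ᵐ[γ₁] fun _ => c) :
    StrictMonoOn (fun r => ∫ u, ψ (mehler r h u) ∂γ₁) (Icc 0 1) := by
  intro r hr t ht hlt
  refine lt_of_le_of_ne (H.monotoneOn_mehler hm hi hS hψ hr ht hlt.le) fun heq => hconst ?_
  have ht0 : 0 < t := hr.1.trans_lt hlt
  have ht1 : |t| ≤ 1 := abs_le.2 ⟨by linarith [ht.1], ht.2⟩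
  have hs : |r / t| < 1 := by
    rw [abs_of_nonneg (div_nonneg hr.1 ht0.le), div_lt_one ht0]; exact hlt
  have hmul := mehler_mul hs.le ht1 hm hi
  rw [div_mul_cancel₀ _ ht0.ne'] at hmul
  have hc : ∫ u, ψ (mehler r h u) ∂γ₁ = ∫ u, ψ (mehler (r / t) (mehler t h) u) ∂γ₁ :=
    integral_congr_ae (by filter_upwards [hmul] with u hu; rw [hu])
  simp only at heq
  rw [hc] at heq
  obtain ⟨c, hc⟩ := H.ae_const_of_integral_mehler_eq (stronglyMeasurable_mehler t hm).measurable
    (_root_.integrable_mehler ht1 hi)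
    (by filter_upwards [H.ae_mehler hi hS hψ ht1] with u hu using hu.1)
    (H.integrable_mehler hm hi hS hψ ht1) hs heq
  have hc0 : 0 ≤ c := by
    obtain ⟨u, hu⟩ := hc.exists
    exact (integral_nonneg fun z => hn _).trans hu.le
  exact ⟨c, ae_const_of_mehler_ae_const ht1 ht0.ne' hn hm hi hc0 hc⟩

/-- Changing the sign of r reflects u, and N(0,1) is symmetric. -/
theorem integral_comp_mehler_neg (ψ h : ℝ → ℝ) (r : ℝ) :
    ∫ u, ψ (mehler (-r) h u) ∂γ₁ = ∫ u, ψ (mehler r h u) ∂γ₁ := by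
  have hmap : (γ₁).map (MeasurableEquiv.neg ℝ) = γ₁ := by
    have := gaussianReal_map_neg (μ := 0) (v := 1)
    rw [neg_zero] at this
    exact this
  simp_rw [mehler_neg]
  conv_rhs => rw [← hmap, integral_map_equiv]
  rfl

theorem integral_comp_mehler_abs (ψ h : ℝ → ℝ) (r : ℝ) :
    ∫ u, ψ (mehler |r| h u) ∂γ₁ = ∫ u, ψ (mehler r h u) ∂γ₁ := by
  rcases abs_choice r with hr | hr <;> rw [hr]
  exact integral_comp_mehler_neg ψ h r

end Jensen

/-! ### The overlap divergence of a linear projection -/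

section Overlap

local notation "γ₁" => gaussianReal 0 1

/-- The density of a projection is the conditional expectation of h(w'x) given v'x, and the
conditional law of w'x given v'x = u is that of ru + √(1 - r²) Z with r = w'v. -/
theorem stdGaussian_withDensity_map_inner {E : Type*} [NormedAddCommGroup E]
    [InnerProductSpace ℝ E] [FiniteDimensional ℝ E] [MeasurableSpace E] [BorelSpace E] {v w : E}
    (hv : ‖v‖ = 1) (hw : ‖w‖ = 1) {h : ℝ → ℝ} (hn : ∀ z, 0 ≤ h z) (hm : Measurable h)
    (hi : Integrable h γ₁) :
    ((stdGaussian E).withDensity fun x => ENNReal.ofReal (h (inner ℝ w x))).map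
        (fun x => inner ℝ v x)
      = (γ₁).withDensity fun u => ENNReal.ofReal (mehler (inner ℝ w v) h u) := by
  have hr : |inner ℝ w v| ≤ 1 := by simpa [hv, hw] using abs_real_inner_le_norm w v
  ext A hA
  let F : ℝ × ℝ → ℝ≥0∞ := fun p => A.indicator 1 p.1 * ENNReal.ofReal (h p.2)
  have hF : Measurable F :=
    ((measurable_one.indicator hA).comp measurable_fst).mul (by fun_prop)
  have hmv : Measurable fun x : E => (inner ℝ v x : ℝ) := by fun_prop
  rw [Measure.map_apply hmv hA, withDensity_apply _ (hmv hA), withDensity_apply _ hA,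
    ← lintegral_indicator (hmv hA), ← lintegral_indicator hA]
  calc ∫⁻ x, ((fun x => inner ℝ v x) ⁻¹' A).indicator
          (fun x => ENNReal.ofReal (h (inner ℝ w x))) x ∂(stdGaussian E)
      = ∫⁻ x, F (inner ℝ v x, inner ℝ w x) ∂(stdGaussian E) := by
        congr 1 with x
        by_cases hx : inner ℝ v x ∈ A <;> simp [F, hx]
    _ = ∫⁻ p, F p ∂((γ₁).prod γ₁).map (correlate (inner ℝ w v)) := by
        rw [← stdGaussian_map_inner_pair hv hw, lintegral_map hF (by fun_prop)]
    _ = ∫⁻ u, ∫⁻ z, F (correlate (inner ℝ w v) (u, z)) ∂γ₁ ∂γ₁ := by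
        rw [lintegral_map hF (by fun_prop), lintegral_prod _ (by fun_prop)]
    _ = ∫⁻ u, A.indicator (fun u => ENNReal.ofReal (mehler (inner ℝ w v) h u)) u ∂γ₁ := by
        refine lintegral_congr_ae ?_
        filter_upwards [ae_integrable_mehler hr hi] with u hu
        simp only [F, correlate]
        rw [lintegral_const_mul _ (by fun_prop),
          ← ofReal_integral_eq_lintegral_ofReal hu (Filter.Eventually.of_forall fun z => hn _)]
        by_cases hx : u ∈ A <;> simp [hx, mehler]

/-- Positivity of f₀ gives absolute continuity with density ratio f₁/f₀; its square times f₀ is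
f₁²/f₀. -/
theorem overlapDivergence_of_densities {Ω : Type*} [MeasurableSpace Ω] {P : Measure Ω}
    {T : Ω → Bool} {Z : Ω → ℝ} (hZ : Measurable Z) {ν : Measure ℝ} [IsFiniteMeasure ν]
    {f₀ f₁ : ℝ → ℝ} (hm₀ : Measurable f₀) (hm₁ : Measurable f₁)
    (hp₀ : ∀ᵐ u ∂ν, 0 < f₀ u) (hn₁ : ∀ᵐ u ∂ν, 0 ≤ f₁ u)
    (h₀ : (controlLaw P T).map Z = ν.withDensity fun u => ENNReal.ofReal (f₀ u))
    (h₁ : (treatedLaw P T).map Z = ν.withDensity fun u => ENNReal.ofReal (f₁ u))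
    [SigmaFinite ((controlLaw P T).map Z)] :
    overlapDivergence P T Z = ∫⁻ u, ENNReal.ofReal (f₁ u ^ 2 / f₀ u) ∂ν := by
  let r : ℝ → ℝ≥0∞ := fun u => ENNReal.ofReal (f₁ u / f₀ u)
  have hr : Measurable r := by fun_prop
  have h : (treatedLaw P T).map Z = ((controlLaw P T).map Z).withDensity r := by
    rw [h₁, h₀, ← withDensity_mul _ (by fun_prop) hr]
    refine withDensity_congr_ae ?_
    filter_upwards [hp₀] with u hu
    simp only [r, Pi.mul_apply]
    rw [← ENNReal.ofReal_mul hu.le, mul_div_cancel₀ _ hu.ne']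
  have hac : (treatedLaw P T).map Z ≪ (controlLaw P T).map Z := by
    rw [h]; exact withDensity_absolutelyContinuous _ _
  rw [overlapDivergence, if_pos hac]
  have hd : ((treatedLaw P T).map Z).rnDeriv ((controlLaw P T).map Z)
      =ᵐ[(controlLaw P T).map Z] r := by
    conv_lhs => rw [h]
    exact Measure.rnDeriv_withDensity _ hr
  calc ∫⁻ ω, ((treatedLaw P T).map Z).rnDeriv ((controlLaw P T).map Z) (Z ω) ^ 2 ∂controlLaw P T
      = ∫⁻ u, ((treatedLaw P T).map Z).rnDeriv ((controlLaw P T).map Z) u ^ 2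
          ∂((controlLaw P T).map Z) :=
        (lintegral_map ((Measure.measurable_rnDeriv _ _).pow_const 2) hZ).symm
    _ = ∫⁻ u, r u ^ 2 ∂((controlLaw P T).map Z) :=
        lintegral_congr_ae (by filter_upwards [hd] with u hu; rw [hu])
    _ = ∫⁻ u, ENNReal.ofReal (f₁ u ^ 2 / f₀ u) ∂ν := by
        rw [h₀, lintegral_withDensity_eq_lintegral_mul _ (by fun_prop) (by fun_prop)]
        refine lintegral_congr_ae ?_
        filter_upwards [hp₀, hn₁] with u hu hu1
        simp only [r, Pi.mul_apply]
        rw [← ENNReal.ofReal_pow (div_nonneg hu1 hu.le), ← ENNReal.ofReal_mul hu.le]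
        congr 1
        field_simp

theorem overlapDivergence_inner {Ω : Type*} [MeasurableSpace Ω] {P : Measure Ω}
    [IsFiniteMeasure P] {d : ℕ} {X : Ω → EuclideanSpace ℝ (Fin d)} {T : Ω → Bool}
    (hX : Measurable X) {v w : EuclideanSpace ℝ (Fin d)} (hv : ‖v‖ = 1) (hw : ‖w‖ = 1)
    {k₀ k₁ : ℝ → ℝ} (hm₀ : Measurable k₀) (hm₁ : Measurable k₁) (hn₀ : ∀ z, 0 ≤ k₀ z)
    (hn₁ : ∀ z, 0 ≤ k₁ z) (hi₀ : Integrable k₀ γ₁) (hi₁ : Integrable k₁ γ₁)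
    (hp₀ : ∀ᵐ u ∂γ₁, 0 < mehler (inner ℝ w v) k₀ u)
    (h₀ : (controlLaw P T).map X
      = (stdGaussian _).withDensity fun x => ENNReal.ofReal (k₀ (inner ℝ w x)))
    (h₁ : (treatedLaw P T).map X
      = (stdGaussian _).withDensity fun x => ENNReal.ofReal (k₁ (inner ℝ w x))) :
    overlapDivergence P T (fun ω => (inner ℝ v (X ω) : ℝ))
      = ∫⁻ u, ENNReal.ofReal (mehler (inner ℝ w v) k₁ u ^ 2 / mehler (inner ℝ w v) k₀ u) ∂γ₁ := by
  have hmv : Measurable fun x : EuclideanSpace ℝ (Fin d) => (inner ℝ v x : ℝ) := by fun_prop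
  have : IsFiniteMeasure (controlLaw P T) := by unfold controlLaw; infer_instance
  refine overlapDivergence_of_densities (hmv.comp hX) (stronglyMeasurable_mehler _ hm₀).measurable
    (stronglyMeasurable_mehler _ hm₁).measurable hp₀
    (Filter.Eventually.of_forall fun u => integral_nonneg fun z => hn₁ _) ?_ ?_
  · rw [← stdGaussian_withDensity_map_inner hv hw hn₀ hm₀ hi₀, ← h₀, Measure.map_map hmv hX]
  · rw [← stdGaussian_withDensity_map_inner hv hw hn₁ hm₁ hi₁, ← h₁, Measure.map_map hmv hX]

/-- Bayes' rule: integrating the conditional probability f(X) over {X ∈ B} gives P(A ∩ {X ∈ B}), and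
conditioning divides by P(A). -/
theorem cond_map_eq_withDensity {Ω S : Type*} [MeasurableSpace Ω] [MeasurableSpace S]
    {P : Measure Ω} [IsProbabilityMeasure P] {X : Ω → S} (hX : Measurable X) {A : Set Ω}
    (hA : MeasurableSet A) {f : S → ℝ} (hfm : Measurable f) (hf : ∀ x, 0 ≤ f x)
    (hfi : Integrable (fun ω => f (X ω)) P)
    (H : P[A.indicator (fun _ => (1 : ℝ)) | MeasurableSpace.comap X inferInstance]
      =ᵐ[P] fun ω => f (X ω)) :
    (cond P A).map X = (P.map X).withDensity fun x => ENNReal.ofReal (f x / P.real A) := by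
  ext B hB
  have hm : MeasurableSpace.comap X inferInstance ≤ ‹MeasurableSpace Ω› := hX.comap_le
  have hset : ∫ ω in X ⁻¹' B, f (X ω) ∂P = P.real (A ∩ X ⁻¹' B) := by
    have h1 := setIntegral_condExp hm (μ := P) (f := A.indicator fun _ => (1 : ℝ))
      ((integrable_const 1).indicator hA) (s := X ⁻¹' B) ⟨B, hB, rfl⟩
    rw [setIntegral_congr_ae (g := fun ω => f (X ω)) (hX hB)
      (by filter_upwards [H] with ω hω _ using hω)] at h1
    rw [h1, integral_indicator hA]
    simp [Measure.restrict_restrict hA]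
  have hl : ∫⁻ ω in X ⁻¹' B, ENNReal.ofReal (f (X ω)) ∂P = P (A ∩ X ⁻¹' B) := by
    rw [← ofReal_integral_eq_lintegral_ofReal hfi.integrableOn
      (Filter.Eventually.of_forall fun ω => hf _), hset, ofReal_measureReal]
  rw [Measure.map_apply hX hB, cond_apply hA, withDensity_apply _ hB,
    setLIntegral_map hB (by fun_prop) hX]
  have : ∀ ω, ENNReal.ofReal (f (X ω) / P.real A)
      = ENNReal.ofReal (P.real A)⁻¹ * ENNReal.ofReal (f (X ω)) := fun ω => by
    rw [← ENNReal.ofReal_mul (by positivity), div_eq_inv_mul]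
  simp_rw [this]
  rw [lintegral_const_mul _ (by fun_prop), hl]
  by_cases h0 : P A = 0
  · simp [measure_mono_null inter_subset_left h0]
  · rw [ENNReal.ofReal_inv_of_pos (show 0 < P.real A from ENNReal.toReal_pos h0 (measure_ne_top _ _)),
      ofReal_measureReal]

end Overlap

/-! ### Monotonicity of the divergence in |β'γ| -/

section Association

local notation "γ₁" => gaussianReal 0 1

variable {E : Type*} [NormedAddCommGroup E] [InnerProductSpace ℝ E] {S : Set ℝ} {ψ ψ' : ℝ → ℝ}
  {h : ℝ → ℝ} {β : E} {O : E → ℝ≥0∞} {c : ℝ}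

theorem StrictSupport.nondecreasingInAssociation (H : StrictSupport S ψ ψ') (hm : Measurable h)
    (hi : Integrable h γ₁) (hS : ∀ᵐ x ∂γ₁, h x ∈ S) (hψ : Integrable (fun x => ψ (h x)) γ₁)
    (hc : 0 < c)
    (hO : ∀ v, ‖v‖ = 1 → O v = ENNReal.ofReal (c * ∫ u, ψ (mehler (inner ℝ β v) h u) ∂γ₁)) :
    NondecreasingInAssociation β O := by
  refine ⟨fun r => ENNReal.ofReal (c * ∫ u, ψ (mehler r h u) ∂γ₁), fun r hr t ht hrt => ?_,
    fun v hv => ?_⟩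
  · exact ENNReal.ofReal_le_ofReal
      (mul_le_mul_of_nonneg_left (H.monotoneOn_mehler hm hi hS hψ hr ht hrt) hc.le)
  · simp only
    rw [hO v hv, integral_comp_mehler_abs]

theorem StrictSupport.increasingInAssociation (H : StrictSupport S ψ ψ') (hm : Measurable h)
    (hn : ∀ z, 0 ≤ h z) (hi : Integrable h γ₁) (hS : ∀ᵐ x ∂γ₁, h x ∈ S)
    (hψ : Integrable (fun x => ψ (h x)) γ₁) (hconst : ¬ ∃ a, h =ᵐ[γ₁] fun _ => a) (hc : 0 < c)
    (hO : ∀ v, ‖v‖ = 1 → O v = ENNReal.ofReal (c * ∫ u, ψ (mehler (inner ℝ β v) h u) ∂γ₁)) :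
    IncreasingInAssociation β O := by
  refine ⟨fun r => ENNReal.ofReal (c * ∫ u, ψ (mehler r h u) ∂γ₁), fun r hr t ht hrt => ?_,
    fun v hv => ?_⟩
  · have hlt := H.strictMonoOn_mehler hm hn hi hS hψ hconst hr ht hrt
    have hr1 : |r| ≤ 1 := abs_le.2 ⟨by linarith [hr.1], hr.2⟩
    -- `ENNReal.ofReal` preserves a strict inequality only if the larger side is positive, which
    -- nonnegativity of the smaller one ensures.
    have h0 : 0 ≤ ∫ u, ψ (mehler r h u) ∂γ₁ := integral_nonneg_of_ae (by
      filter_upwards [H.ae_mehler hi hS hψ hr1] with u hu using H.nonneg _ hu.1)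
    exact (ENNReal.ofReal_lt_ofReal_iff (mul_pos hc (h0.trans_lt hlt))).2
      (mul_lt_mul_of_pos_left hlt hc)
  · simp only
    rw [hO v hv, integral_comp_mehler_abs]

end Association

/-! ### Geometry of the hyperbola family -/

section Geometry

variable {E : Type*} [NormedAddCommGroup E] [InnerProductSpace ℝ E] {α β γ : E} {w₁ w₂ : ℝ}

/-- Used with x = 1 ± α'β, where 2x = ‖α ± β‖² for unit vectors. -/
theorem div_sqrt_two_mul {x w : ℝ} (hx : 0 < x) : w / √(2 * x) * x = w * √(x / 2) := by
  have h1 : √(2 * x) ≠ 0 := (Real.sqrt_pos.2 (by linarith)).ne'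
  have h2 : √(2 * x) * √(x / 2) = x := by
    rw [← Real.sqrt_mul (by linarith), show 2 * x * (x / 2) = x ^ 2 by ring, Real.sqrt_sq hx.le]
  rw [div_mul_eq_mul_div, div_eq_iff h1, mul_assoc, mul_comm (√(x / 2)), h2]

theorem HyperbolaCoords.inner_right (hβ : ‖β‖ = 1)
    (hρ : inner ℝ α β ∈ Ioo (-1 : ℝ) 1) (H : HyperbolaCoords α β γ w₁ w₂) :
    inner ℝ β γ = w₁ * √((1 + inner ℝ α β) / 2) - w₂ * √((1 - inner ℝ α β) / 2) := by
  obtain ⟨-, -, n, hn, -, rfl⟩ := H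
  have hn0 : inner ℝ β n = 0 := hn β (Submodule.subset_span (by simp))
  simp only [inner_add_right, inner_sub_right, real_inner_smul_right, hn0,
    real_inner_self_eq_norm_sq, hβ, real_inner_comm α β]
  have h1 := div_sqrt_two_mul (w := w₁) (show 0 < 1 + inner ℝ α β by linarith [hρ.1])
  have h2 := div_sqrt_two_mul (w := w₂) (show 0 < 1 - inner ℝ α β by linarith [hρ.2])
  rw [← h1, ← h2]
  ring_nf

theorem HyperbolaCoords.inner_left (hα : ‖α‖ = 1)
    (hρ : inner ℝ α β ∈ Ioo (-1 : ℝ) 1) (H : HyperbolaCoords α β γ w₁ w₂) :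
    inner ℝ α γ = w₁ * √((1 + inner ℝ α β) / 2) + w₂ * √((1 - inner ℝ α β) / 2) := by
  obtain ⟨-, -, n, hn, -, rfl⟩ := H
  have hn0 : inner ℝ α n = 0 := hn α (Submodule.subset_span (by simp))
  simp only [inner_add_right, inner_sub_right, real_inner_smul_right, hn0,
    real_inner_self_eq_norm_sq, hα]
  have h1 := div_sqrt_two_mul (w := w₁) (show 0 < 1 + inner ℝ α β by linarith [hρ.1])
  have h2 := div_sqrt_two_mul (w := w₂) (show 0 < 1 - inner ℝ α β by linarith [hρ.2])
  rw [← h1, ← h2]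
  ring_nf

/-- The two inner products are a sum and a difference of the same terms, so their product is a
difference of squares: half the left side of the hyperbola equation. -/
theorem HyperbolaCoords.inner_mul_inner (hα : ‖α‖ = 1) (hβ : ‖β‖ = 1)
    (hρ : inner ℝ α β ∈ Ioo (-1 : ℝ) 1) (H : HyperbolaCoords α β γ w₁ w₂) :
    (inner ℝ α γ : ℝ) * inner ℝ β γ = inner ℝ α β := by
  rw [H.inner_left hα hρ, H.inner_right hβ hρ]
  have h1 := Real.sq_sqrt (show 0 ≤ (1 + inner ℝ α β) / 2 by linarith [hρ.1])
  have h2 := Real.sq_sqrt (show 0 ≤ (1 - inner ℝ α β) / 2 by linarith [hρ.2])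
  have h3 := H.1
  linear_combination w₁ ^ 2 * h1 - w₂ ^ 2 * h2 + h3 / 2

theorem HyperbolaCoords.norm_eq_one (hα : ‖α‖ = 1) (hβ : ‖β‖ = 1)
    (hρ : inner ℝ α β ∈ Ioo (-1 : ℝ) 1) (H : HyperbolaCoords α β γ w₁ w₂) : ‖γ‖ = 1 := by
  have hl := H.inner_left hα hρ
  have hr := H.inner_right hβ hρ
  obtain ⟨-, hd, n, hn, hnn, hγ⟩ := H
  have hnα : inner ℝ α n = 0 := hn α (Submodule.subset_span (by simp))
  have hnβ : inner ℝ β n = 0 := hn β (Submodule.subset_span (by simp))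
  have hnγ : inner ℝ γ n = ‖n‖ ^ 2 := by
    rw [hγ]
    simp [inner_add_left, inner_sub_left, real_inner_smul_left, hnα, hnβ]
  have hsq : ‖γ‖ ^ 2 = 1 := by
    rw [← real_inner_self_eq_norm_sq]
    conv_lhs => arg 2; rw [hγ]
    simp only [inner_add_left, inner_sub_left, real_inner_smul_left]
    rw [hl, hr, real_inner_comm γ n, hnγ, hnn, Real.sq_sqrt (by linarith)]
    have h1 : ∀ {x w : ℝ}, 0 < x → w / √(2 * x) * (w * √(x / 2)) = w ^ 2 / 2 := by
      intro x w hx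
      have := div_sqrt_two_mul (w := w) hx
      have h2 := Real.sq_sqrt (show 0 ≤ x / 2 by linarith)
      have : w / √(2 * x) * (w * √(x / 2)) * x = w ^ 2 / 2 * x := by
        linear_combination w * √(x / 2) * this + w ^ 2 * h2
      exact mul_right_cancel₀ hx.ne' this
    have e1 := h1 (w := w₁) (show 0 < 1 + inner ℝ α β by linarith [hρ.1])
    have e2 := h1 (w := w₂) (show 0 < 1 - inner ℝ α β by linarith [hρ.2])
    rw [mul_add, mul_one] at e1
    rw [mul_sub, mul_one] at e2
    linear_combination 2 * e1 + 2 * e2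
  nlinarith [norm_nonneg γ]

theorem hyperbolaCoords_left (hρ : inner ℝ α β ∈ Ioo (-1 : ℝ) 1)
    {ε : ℝ} (hε : ε = 1 ∨ ε = -1) :
    HyperbolaCoords α β (ε • α) (ε * √((1 + inner ℝ α β) / 2)) (ε * √((1 - inner ℝ α β) / 2)) := by
  have hp : 0 < 1 + (inner ℝ α β : ℝ) := by linarith [hρ.1]
  have hq : 0 < 1 - (inner ℝ α β : ℝ) := by linarith [hρ.2]
  have hε2 : ε ^ 2 = 1 := by rcases hε with rfl | rfl <;> norm_num
  have h1 := Real.sq_sqrt (show 0 ≤ (1 + inner ℝ α β) / 2 by linarith)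
  have h2 := Real.sq_sqrt (show 0 ≤ (1 - inner ℝ α β) / 2 by linarith)
  have hk : ∀ {x : ℝ}, 0 < x → ε * √(x / 2) / √(2 * x) = ε / 2 := by
    intro x hx
    have := div_sqrt_two_mul (w := ε * √(x / 2)) hx
    have h2 := Real.sq_sqrt (show 0 ≤ x / 2 by linarith)
    refine mul_right_cancel₀ hx.ne' ?_
    rw [this]; linear_combination ε * h2
  refine ⟨?_, ?_, 0, Submodule.zero_mem _, ?_, ?_⟩
  · rw [mul_pow, mul_pow, h1, h2, hε2]; ring
  · rw [mul_pow, mul_pow, h1, h2, hε2]; apply le_of_eq; ring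
  · rw [mul_pow, mul_pow, h1, h2, hε2]
    simp only [norm_zero]
    symm; rw [Real.sqrt_eq_zero']; apply le_of_eq; ring
  · have e1 := hk hp
    have e2 := hk hq
    rw [mul_add 2, mul_one] at e1
    rw [mul_sub 2, mul_one] at e2
    rw [e1, e2]
    module

/-- Exchanging α and β flips the sign of w₂. -/
theorem hyperbolaCoords_right (hρ : inner ℝ α β ∈ Ioo (-1 : ℝ) 1)
    {ε : ℝ} (hε : ε = 1 ∨ ε = -1) :
    HyperbolaCoords α β (ε • β) (ε * √((1 + inner ℝ α β) / 2))
      (-(ε * √((1 - inner ℝ α β) / 2))) := by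
  have h := hyperbolaCoords_left (α := β) (β := α) (by rwa [real_inner_comm]) hε
  rw [HyperbolaCoords] at h
  simp only [real_inner_comm α β] at h
  obtain ⟨h1, h2, n, hn, h3, h4⟩ := h
  refine ⟨by rw [neg_sq]; exact h1, by rw [neg_sq]; exact h2, n, by rwa [pair_comm], ?_, ?_⟩
  · rw [neg_sq]; exact h3
  · rw [h4]; module

/-- For unit α, β put p = √((1 - |α'β|)/2) t. On the portion |β'γ| |α'γ| = |α'β| and |β'γ| - |α'γ| =
2p, so |β'γ| is the positive root of x² - 2px - |α'β| = 0. -/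
theorem PortionAt.abs_inner (hβ : ‖β‖ = 1) (hρ : inner ℝ α β ∈ Ioo (-1 : ℝ) 1)
    {ε t : ℝ} (hε : ε = 1 ∨ ε = -1) (H : PortionAt α β ε γ t) :
    |inner ℝ β γ| = √(|inner ℝ α β| + (√((1 - |inner ℝ α β|) / 2) * t) ^ 2)
      + √((1 - |inner ℝ α β|) / 2) * t := by
  obtain ⟨w₁, w₂, hc, h⟩ := H
  have hin := hc.inner_right hβ hρ
  have hhyp := hc.1
  have h1 := Real.sq_sqrt (show 0 ≤ (1 + inner ℝ α β) / 2 by linarith [hρ.1])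
  have h2 := Real.sq_sqrt (show 0 ≤ (1 - inner ℝ α β) / 2 by linarith [hρ.2])
  set ρ : ℝ := inner ℝ α β with hρdef
  have hε2 : ε ^ 2 = 1 := by rcases hε with rfl | rfl <;> norm_num
  have habs : ∀ x : ℝ, |x| = |ε * x| := fun x => by rcases hε with rfl | rfl <;> simp
  have hpos : ∀ {a p : ℝ}, 0 < a → 0 ≤ √(a + p ^ 2) + p := fun {a p} ha => by
    have : |p| ≤ √(a + p ^ 2) := Real.abs_le_sqrt (by linarith)
    linarith [neg_abs_le p]
  rcases h with ⟨hs, hw, rfl⟩ | ⟨hs, hw, rfl⟩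
  · rw [abs_of_pos hs]
    -- The hyperbola equation makes the radicand a perfect square, and the sign condition defining
    -- the portion selects its root.
    have : √(ρ + (√((1 - ρ) / 2) * -(ε * w₂)) ^ 2) = ε * w₁ * √((1 + ρ) / 2) := by
      rw [show ρ + (√((1 - ρ) / 2) * -(ε * w₂)) ^ 2 = (ε * w₁ * √((1 + ρ) / 2)) ^ 2 by
        rw [mul_pow, mul_pow, mul_pow, h1, h2, neg_sq, mul_pow, hε2]
        linear_combination -hhyp / 2]
      exact Real.sqrt_sq (by positivity)
    have hp := hpos (p := √((1 - ρ) / 2) * -(ε * w₂)) hs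
    rw [this] at hp ⊢
    have he : ε * inner ℝ β γ = ε * w₁ * √((1 + ρ) / 2) + √((1 - ρ) / 2) * -(ε * w₂) := by
      rw [hin]; ring
    rw [habs, he, abs_of_nonneg hp]
  · rw [abs_of_neg hs]
    rw [show (1 - -ρ) / 2 = (1 + ρ) / 2 by ring]
    have : √(-ρ + (√((1 + ρ) / 2) * -(ε * w₁)) ^ 2) = ε * w₂ * √((1 - ρ) / 2) := by
      rw [show -ρ + (√((1 + ρ) / 2) * -(ε * w₁)) ^ 2 = (ε * w₂ * √((1 - ρ) / 2)) ^ 2 by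
        rw [mul_pow, mul_pow, mul_pow, h1, h2, neg_sq, mul_pow, hε2]
        linear_combination hhyp / 2]
      exact Real.sqrt_sq (by positivity)
    have hp := hpos (p := √((1 + ρ) / 2) * -(ε * w₁)) (neg_pos.2 hs)
    rw [this] at hp ⊢
    have he : ε * inner ℝ β γ = -(ε * w₂ * √((1 - ρ) / 2) + √((1 + ρ) / 2) * -(ε * w₁)) := by
      rw [hin]; ring
    rw [habs, he, abs_neg, abs_of_nonneg hp]

theorem portionAt_left (hρ : inner ℝ α β ∈ Ioo (-1 : ℝ) 1)
    (h0 : inner ℝ α β ≠ (0 : ℝ)) {ε : ℝ} (hε : ε = 1 ∨ ε = -1) :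
    PortionAt α β ε (ε • α) (-√((1 - |inner ℝ α β|) / 2)) := by
  refine ⟨_, _, hyperbolaCoords_left hρ hε, ?_⟩
  have hε2 : ∀ x, ε * (ε * x) = x := fun x => by rcases hε with rfl | rfl <;> simp
  rw [hε2, hε2]
  rcases lt_or_gt_of_ne h0 with h | h
  · refine Or.inr ⟨h, Real.sqrt_pos.2 (by linarith), ?_⟩
    rw [abs_of_neg h, sub_neg_eq_add]
  · refine Or.inl ⟨h, Real.sqrt_pos.2 (by linarith), ?_⟩
    rw [abs_of_pos h]

theorem portionAt_right (hρ : inner ℝ α β ∈ Ioo (-1 : ℝ) 1)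
    (h0 : inner ℝ α β ≠ (0 : ℝ)) {ε : ℝ} (hε : ε = 1 ∨ ε = -1) :
    PortionAt α β ε ((ε * SignType.sign (inner ℝ α β : ℝ)) • β)
      (√((1 - |inner ℝ α β|) / 2)) := by
  have hε2 : ∀ x, ε * (ε * x) = x := fun x => by rcases hε with rfl | rfl <;> simp
  rcases lt_or_gt_of_ne h0 with h | h
  · have hs : ε * (SignType.sign (inner ℝ α β : ℝ) : ℝ) = -ε := by simp [sign_neg h]
    rw [hs]
    refine ⟨_, _, hyperbolaCoords_right hρ
      (show -ε = 1 ∨ -ε = -1 by rcases hε with rfl | rfl <;> simp), Or.inr ⟨h, ?_, ?_⟩⟩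
    · rw [neg_mul, neg_neg, hε2]; exact Real.sqrt_pos.2 (by linarith)
    · rw [neg_mul, mul_neg, neg_neg, hε2, abs_of_neg h, sub_neg_eq_add]
  · have hs : ε * (SignType.sign (inner ℝ α β : ℝ) : ℝ) = ε := by simp [sign_pos h]
    rw [hs]
    refine ⟨_, _, hyperbolaCoords_right hρ hε, Or.inl ⟨h, ?_, ?_⟩⟩
    · rw [hε2]; exact Real.sqrt_pos.2 (by linarith)
    · rw [mul_neg, neg_neg, hε2, abs_of_pos h]

/-- The positive factors √(a + p²) ± p have product a: if the sum did not grow, the difference would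
not shrink, forcing p not to grow. -/
theorem strictMono_sqrt_add_sq_add {a : ℝ} (ha : 0 < a) :
    StrictMono fun p : ℝ => √(a + p ^ 2) + p := by
  intro p q hpq
  have hp : |p| < √(a + p ^ 2) := Real.lt_sqrt_of_sq_lt (by rw [sq_abs]; linarith)
  have hq : |q| < √(a + q ^ 2) := Real.lt_sqrt_of_sq_lt (by rw [sq_abs]; linarith)
  have hp2 := Real.sq_sqrt (show 0 ≤ a + p ^ 2 by positivity)
  have hq2 := Real.sq_sqrt (show 0 ≤ a + q ^ 2 by positivity)
  simp only
  by_contra! hle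
  have h1 := neg_abs_le p
  have h2 := le_abs_self p
  have h3 := neg_abs_le q
  have h4 := le_abs_self q
  nlinarith

/-- The value of `|β'γ|` at position `t` on a portion is a strictly increasing function of `t` with
values in `[0, 1]`. -/
theorem portion_profile {ρ : ℝ} (hρ : ρ ∈ Ioo (-1 : ℝ) 1) (h0 : ρ ≠ 0) :
    StrictMonoOn (fun t => √(|ρ| + (√((1 - |ρ|) / 2) * t) ^ 2) + √((1 - |ρ|) / 2) * t)
        (Icc (-√((1 - |ρ|) / 2)) (√((1 - |ρ|) / 2))) ∧
      MapsTo (fun t => √(|ρ| + (√((1 - |ρ|) / 2) * t) ^ 2) + √((1 - |ρ|) / 2) * t)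
        (Icc (-√((1 - |ρ|) / 2)) (√((1 - |ρ|) / 2))) (Icc 0 1) := by
  have ha : 0 < |ρ| := abs_pos.2 h0
  have ha1 : |ρ| < 1 := abs_lt.2 hρ
  have hs : 0 < √((1 - |ρ|) / 2) := Real.sqrt_pos.2 (by linarith)
  have hs2 := Real.sq_sqrt (show 0 ≤ (1 - |ρ|) / 2 by linarith)
  have hmono : StrictMono fun t => √(|ρ| + (√((1 - |ρ|) / 2) * t) ^ 2) + √((1 - |ρ|) / 2) * t :=
    (strictMono_sqrt_add_sq_add ha).comp fun x y hxy => mul_lt_mul_of_pos_left hxy hs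
  refine ⟨hmono.strictMonoOn _, fun t ht => ⟨?_, ?_⟩⟩
  · have : |√((1 - |ρ|) / 2) * t| ≤ √(|ρ| + (√((1 - |ρ|) / 2) * t) ^ 2) :=
      Real.abs_le_sqrt (by linarith)
    linarith [neg_abs_le (√((1 - |ρ|) / 2) * t)]
  -- At the right endpoint the value is (1 + |ρ|)/2 + (1 - |ρ|)/2 = 1.
  · refine (hmono.monotone ht.2).trans (le_of_eq ?_)
    rw [← sq, hs2, show |ρ| + ((1 - |ρ|) / 2) ^ 2 = ((1 + |ρ|) / 2) ^ 2 by ring,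
      Real.sqrt_sq (by linarith)]
    ring

variable {O : E → ℝ≥0∞}

theorem NondecreasingInAssociation.alongFamily (H : NondecreasingInAssociation β O)
    (hα : ‖α‖ = 1) (hβ : ‖β‖ = 1) (hρ : inner ℝ α β ∈ Ioo (-1 : ℝ) 1)
    (h0 : inner ℝ α β ≠ (0 : ℝ)) : NondecreasingAlongFamily α β O := by
  obtain ⟨g, hg, hO⟩ := H
  obtain ⟨hm, hmaps⟩ := portion_profile hρ h0
  refine fun ε hε => ⟨_, hg.comp hm.monotoneOn hmaps, fun γ t h => ?_,
    portionAt_left hρ h0 hε, portionAt_right hρ h0 hε⟩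
  have hu : ‖γ‖ = 1 := by obtain ⟨_, _, hc, _⟩ := h; exact hc.norm_eq_one hα hβ hρ
  rw [hO γ hu, h.abs_inner hβ hρ hε]
  rfl

theorem IncreasingInAssociation.alongFamily (H : IncreasingInAssociation β O)
    (hα : ‖α‖ = 1) (hβ : ‖β‖ = 1) (hρ : inner ℝ α β ∈ Ioo (-1 : ℝ) 1)
    (h0 : inner ℝ α β ≠ (0 : ℝ)) : IncreasingAlongFamily α β O := by
  obtain ⟨g, hg, hO⟩ := H
  obtain ⟨hm, hmaps⟩ := portion_profile hρ h0
  refine fun ε hε => ⟨_, hg.comp hm hmaps, fun γ t h => ?_,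
    portionAt_left hρ h0 hε, portionAt_right hρ h0 hε⟩
  have hu : ‖γ‖ = 1 := by obtain ⟨_, _, hc, _⟩ := h; exact hc.norm_eq_one hα hβ hρ
  rw [hO γ hu, h.abs_inner hβ hρ hε]
  rfl

theorem IncreasingInAssociation.nondecreasing (H : IncreasingInAssociation β O) :
    NondecreasingInAssociation β O := by
  obtain ⟨g, hg, hO⟩ := H
  exact ⟨g, hg.monotoneOn, hO⟩

theorem norm_eq_one_of_mem_hyperbolaFamily (hα : ‖α‖ = 1) (hβ : ‖β‖ = 1)
    (hρ : inner ℝ α β ∈ Ioo (-1 : ℝ) 1) (h : γ ∈ hyperbolaFamily α β) : ‖γ‖ = 1 := by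
  obtain ⟨_, _, hc⟩ := h
  exact hc.norm_eq_one hα hβ hρ

theorem abs_inner_mem_Icc (hβ : ‖β‖ = 1) (hγ : ‖γ‖ = 1) : |inner ℝ β γ| ∈ Icc (0 : ℝ) 1 :=
  ⟨abs_nonneg _, by simpa [hβ, hγ] using abs_real_inner_le_norm β γ⟩

theorem mem_hyperbolaFamily_of_mem_pair
    (hρ : inner ℝ α β ∈ Ioo (-1 : ℝ) 1) (h : γ ∈ ({α, -α} : Set E)) :
    γ ∈ hyperbolaFamily α β := by
  rcases h with rfl | rfl
  · have := hyperbolaCoords_left hρ (ε := 1) (Or.inl rfl)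
    rw [one_smul] at this
    exact ⟨_, _, this⟩
  · have := hyperbolaCoords_left hρ (ε := -1) (Or.inr rfl)
    rw [neg_one_smul] at this
    exact ⟨_, _, this⟩

/-- On the hyperbola family `|α'β| ≤ |β'γ|`. -/
theorem abs_inner_le_of_mem_hyperbolaFamily (hα : ‖α‖ = 1) (hβ : ‖β‖ = 1)
    (hρ : inner ℝ α β ∈ Ioo (-1 : ℝ) 1) (h : γ ∈ hyperbolaFamily α β) :
    |inner ℝ α β| ≤ |inner ℝ β γ| := by
  have hγ := norm_eq_one_of_mem_hyperbolaFamily hα hβ hρ h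
  obtain ⟨_, _, hc⟩ := h
  rw [← hc.inner_mul_inner hα hβ hρ, abs_mul]
  exact mul_le_of_le_one_left (abs_nonneg _) (abs_inner_mem_Icc hα hγ).2

theorem NondecreasingInAssociation.mem_familyMinimizers (H : NondecreasingInAssociation β O)
    (hα : ‖α‖ = 1) (hβ : ‖β‖ = 1) (hρ : inner ℝ α β ∈ Ioo (-1 : ℝ) 1)
    (h : γ ∈ hyperbolaFamily α β) (hmin : |inner ℝ β γ| = |inner ℝ α β|) :
    γ ∈ familyMinimizers α β O := by
  obtain ⟨g, hg, hO⟩ := H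
  refine ⟨h, fun δ hδ => ?_⟩
  have hγ := norm_eq_one_of_mem_hyperbolaFamily hα hβ hρ h
  have hδ1 := norm_eq_one_of_mem_hyperbolaFamily hα hβ hρ hδ
  simp only [mem_ofPred_eq]
  rw [hO γ hγ, hO δ hδ1]
  refine hg (abs_inner_mem_Icc hβ hγ) (abs_inner_mem_Icc hβ hδ1) ?_
  rw [hmin]
  exact abs_inner_le_of_mem_hyperbolaFamily hα hβ hρ hδ

/-- The family contains α, which attains the lower bound |α'β|; strict monotonicity excludes
minimizers above it. -/
theorem IncreasingInAssociation.abs_inner_eq (H : IncreasingInAssociation β O)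
    (hα : ‖α‖ = 1) (hβ : ‖β‖ = 1) (hρ : inner ℝ α β ∈ Ioo (-1 : ℝ) 1)
    (h : γ ∈ familyMinimizers α β O) : |inner ℝ β γ| = |inner ℝ α β| := by
  obtain ⟨g, hg, hO⟩ := H
  have hγ := norm_eq_one_of_mem_hyperbolaFamily hα hβ hρ h.1
  have hle := h.2 (mem_hyperbolaFamily_of_mem_pair hρ (mem_insert α {-α}))
  simp only [mem_ofPred_eq] at hle
  rw [hO γ hγ, hO α hα, hg.le_iff_le (abs_inner_mem_Icc hβ hγ) (abs_inner_mem_Icc hβ hα),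
    real_inner_comm] at hle
  rw [real_inner_comm] at hle
  have := abs_inner_le_of_mem_hyperbolaFamily hα hβ hρ h.1
  refine le_antisymm ?_ this
  simpa only [real_inner_comm] using hle

theorem NondecreasingInAssociation.pair_subset (H : NondecreasingInAssociation β O)
    (hα : ‖α‖ = 1) (hβ : ‖β‖ = 1) (hρ : inner ℝ α β ∈ Ioo (-1 : ℝ) 1) :
    {α, -α} ⊆ familyMinimizers α β O := fun γ hγ =>
  H.mem_familyMinimizers hα hβ hρ (mem_hyperbolaFamily_of_mem_pair hρ hγ) (by
    rcases hγ with rfl | rfl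
    · rw [real_inner_comm]
    · rw [inner_neg_right, abs_neg, real_inner_comm])

theorem IncreasingInAssociation.familyMinimizers_eq_pair (H : IncreasingInAssociation β O)
    (hα : ‖α‖ = 1) (hβ : ‖β‖ = 1) (hρ : inner ℝ α β ∈ Ioo (-1 : ℝ) 1)
    (h0 : inner ℝ α β ≠ (0 : ℝ)) : familyMinimizers α β O = {α, -α} := by
  refine Subset.antisymm (fun γ h => ?_) (H.nondecreasing.pair_subset hα hβ hρ)
  have heq := H.abs_inner_eq hα hβ hρ h
  have hγ := norm_eq_one_of_mem_hyperbolaFamily hα hβ hρ h.1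
  obtain ⟨_, _, hc⟩ := h.1
  have hmul := congrArg abs (hc.inner_mul_inner hα hβ hρ)
  rw [abs_mul, heq] at hmul
  have h1 : |inner ℝ α γ| = (1 : ℝ) := by
    have := abs_pos.2 h0
    exact mul_right_cancel₀ this.ne' (by rw [hmul, one_mul])
  rcases (abs_eq zero_le_one).1 h1 with h2 | h2
  · exact Or.inl ((inner_eq_one_iff_of_norm_eq_one hα hγ).1 h2).symm
  · refine Or.inr ?_
    have := (inner_eq_one_iff_of_norm_eq_one (𝕜 := ℝ) hα (y := -γ) (by rwa [norm_neg])).1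
      (by rw [inner_neg_right, h2, neg_neg])
    rw [this, neg_neg]; rfl

/-- If β'γ = 0 the projection is (α'γ)α, and |α'γ| ≤ 1 places it in the segment; conversely
multiples of α are orthogonal to β. -/
theorem mem_projectsToSegment_iff [FiniteDimensional ℝ E] (hα : ‖α‖ = 1)
    (h0 : inner ℝ α β = (0 : ℝ)) :
    γ ∈ projectsToSegment α β ↔ ‖γ‖ = 1 ∧ inner ℝ β γ = (0 : ℝ) := by
  have hαs : α ∈ Submodule.span ℝ {α, β} := Submodule.subset_span (by simp)
  have hβs : β ∈ Submodule.span ℝ {α, β} := Submodule.subset_span (by simp)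
  refine and_congr_right fun hγ => ⟨fun h => ?_, fun h => ?_⟩
  · obtain ⟨a, b, -, -, -, hab⟩ := h
    have : inner ℝ β γ = inner ℝ β ((Submodule.span ℝ {α, β}).starProjection γ) := by
      have := Submodule.starProjection_inner_eq_zero (K := Submodule.span ℝ {α, β}) γ β hβs
      rw [inner_sub_left, sub_eq_zero] at this
      rw [real_inner_comm, this, real_inner_comm]
    rw [this, ← hab, inner_add_right, real_inner_smul_right, real_inner_smul_right,
      inner_neg_right, real_inner_comm, h0]
    simp
  · have hproj : (Submodule.span ℝ {α, β}).starProjection γ = (inner ℝ α γ : ℝ) • α := by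
      refine (Submodule.eq_starProjection_of_mem_of_inner_eq_zero
        (Submodule.smul_mem _ _ hαs) fun w hw => ?_)
      obtain ⟨a, b, rfl⟩ := Submodule.mem_span_pair.1 hw
      simp only [inner_add_right, inner_sub_left, real_inner_smul_right, real_inner_smul_left,
        real_inner_self_eq_norm_sq, hα, h0, real_inner_comm α γ, real_inner_comm β γ, h]
      ring
    rw [hproj]
    have hc := abs_le.1 (abs_inner_mem_Icc hα hγ).2
    refine ⟨(1 - inner ℝ α γ) / 2, (1 + inner ℝ α γ) / 2, by linarith, by linarith, by ring, ?_⟩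
    module

theorem mem_hyperbolaFamily_of_inner_eq_zero (hα : ‖α‖ = 1)
    (h0 : inner ℝ α β = (0 : ℝ)) (hγ : ‖γ‖ = 1) (h : inner ℝ β γ = (0 : ℝ)) :
    γ ∈ hyperbolaFamily α β := by
  have hc := abs_le.1 (abs_inner_mem_Icc hα hγ).2
  set c : ℝ := inner ℝ α γ with hcdef
  have hs : √(2 : ℝ) ^ 2 = 2 := Real.sq_sqrt (by norm_num)
  have hc2 : (c / √2) ^ 2 = c ^ 2 / 2 := by rw [div_pow, hs]
  have hc1 : c ^ 2 ≤ 1 := by nlinarith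
  -- For α'β = 0 the hyperbola degenerates to the lines w₁ = ±w₂; on w₁ = w₂ the β-components
  -- cancel, leaving cα.
  refine ⟨c / √2, c / √2, ?_, ?_, γ - c • α, ?_, ?_, ?_⟩
  · rw [h0]; ring
  · rw [hc2]; linarith
  · intro w hw
    obtain ⟨a, b, rfl⟩ := Submodule.mem_span_pair.1 hw
    simp only [inner_add_left, inner_sub_right, real_inner_smul_right, real_inner_smul_left,
      real_inner_self_eq_norm_sq, hα, h, ← hcdef]
    rw [real_inner_comm, h0]
    ring
  · rw [hc2, show 1 - c ^ 2 / 2 - c ^ 2 / 2 = ‖γ - c • α‖ ^ 2 by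
      rw [norm_sub_sq_real, hγ, norm_smul, hα, real_inner_smul_right, real_inner_comm, ← hcdef,
        mul_one, Real.norm_eq_abs, sq_abs]
      ring]
    exact (Real.sqrt_sq (norm_nonneg _)).symm
  · rw [h0, mul_zero, add_zero, sub_zero, div_div, ← sq, hs]
    module

theorem NondecreasingInAssociation.projectsToSegment_subset [FiniteDimensional ℝ E]
    (H : NondecreasingInAssociation β O)
    (hα : ‖α‖ = 1) (hβ : ‖β‖ = 1) (h0 : inner ℝ α β = (0 : ℝ)) :
    projectsToSegment α β ⊆ familyMinimizers α β O := fun γ hγ => by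
  obtain ⟨h1, h2⟩ := (mem_projectsToSegment_iff hα h0).1 hγ
  exact H.mem_familyMinimizers hα hβ (by rw [h0]; simp)
    (mem_hyperbolaFamily_of_inner_eq_zero hα h0 h1 h2) (by rw [h2, h0])

theorem IncreasingInAssociation.familyMinimizers_eq_projectsToSegment [FiniteDimensional ℝ E]
    (H : IncreasingInAssociation β O) (hα : ‖α‖ = 1) (hβ : ‖β‖ = 1)
    (h0 : inner ℝ α β = (0 : ℝ)) : familyMinimizers α β O = projectsToSegment α β := by
  have hρ : inner ℝ α β ∈ Ioo (-1 : ℝ) 1 := by rw [h0]; simp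
  refine Subset.antisymm (fun γ h => ?_) (H.nondecreasing.projectsToSegment_subset hα hβ h0)
  have heq := H.abs_inner_eq hα hβ hρ h
  rw [h0, abs_zero, abs_eq_zero] at heq
  exact (mem_projectsToSegment_iff hα h0).2
    ⟨norm_eq_one_of_mem_hyperbolaFamily hα hβ hρ h.1, heq⟩

end Geometry

/-! ### Link functions -/

section Links

local notation "γ₁" => gaussianReal 0 1

variable {h : ℝ → ℝ} {K : ℕ} {C lam lam' : ℝ}

theorem integrable_exp_mul_sq {a : ℝ} (ha : a < 1 / 2) :
    Integrable (fun z : ℝ => Real.exp (a * z ^ 2)) γ₁ := by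
  rw [gaussianReal_of_var_ne_zero 0 one_ne_zero, integrable_withDensity_iff
    (measurable_gaussianPDF 0 1) (Filter.Eventually.of_forall fun _ => gaussianPDF_lt_top)]
  have := (integrable_exp_neg_mul_sq (b := 1 / 2 - a) (by linarith)).const_mul (√(2 * Real.pi))⁻¹
  refine this.congr (Filter.Eventually.of_forall fun z => ?_)
  simp only [toReal_gaussianPDF, gaussianPDFReal]
  rw [mul_left_comm, ← Real.exp_add]
  simp only [NNReal.coe_one, mul_one, sub_zero]
  congr 2
  ring

theorem TimesDifferentiable.continuous (hd : TimesDifferentiable K h) (hK : 0 < K) :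
    Continuous h := by
  have := (hd 0 hK).continuous
  rwa [iteratedDeriv_zero] at this

/-- Squaring doubles the growth rate, and 2λ < 1/2 is still beaten by the Gaussian density. -/
theorem integrable_sq_of_mem_linkClass (hh : h ∈ linkClass K C lam) (hK : 0 < K)
    (hlam : lam < 1 / 4) : Integrable (fun z => h z ^ 2) γ₁ := by
  refine ((integrable_exp_mul_sq (a := 2 * lam) (by linarith)).const_mul (C ^ 2)).mono'
    ((hh.1.continuous hK).pow 2).aestronglyMeasurable (Filter.Eventually.of_forall fun z => ?_)
  have hb := hh.2 0 (Nat.zero_le K) z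
  rw [iteratedDeriv_zero] at hb
  rw [Real.norm_of_nonneg (sq_nonneg _), ← sq_abs]
  refine (pow_le_pow_left₀ (abs_nonneg _) hb 2).trans (le_of_eq ?_)
  rw [mul_pow, ← Real.exp_nat_mul]
  congr 2
  push_cast
  ring

theorem integrable_of_mem_propensityLinkClass (hh : h ∈ propensityLinkClass K C lam lam')
    (hK : 0 < K) (hC : 0 < C) (hlam' : lam' < 1 / 2) (hlt : ∀ z, h z < 1) :
    Integrable (fun z => h z ^ 2 / (1 - h z)) γ₁ := by
  have hc := hh.1.continuous hK
  refine ((integrable_exp_mul_sq hlam').const_mul C).mono'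
    ((hc.pow 2).div (continuous_const.sub hc)
      fun z => (sub_pos.2 (hlt z)).ne').aestronglyMeasurable
    (Filter.Eventually.of_forall fun z => ?_)
  obtain ⟨h1, h0⟩ := hh.2.1 z
  have hp := sub_pos.2 (hlt z)
  rw [Real.norm_of_nonneg (div_nonneg (sq_nonneg _) hp.le), div_le_iff₀ hp]
  calc h z ^ 2 ≤ 1 := pow_le_one₀ h0 (hlt z).le
    _ = C * Real.exp (lam' * z ^ 2) * (Real.exp (-lam' * z ^ 2) / C) := by
        field_simp
        rw [← Real.exp_add]
        simp
    _ ≤ C * Real.exp (lam' * z ^ 2) * (1 - h z) := by gcongr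

/-- A set of full Gaussian measure is dense, so it meets both U and V. This serves the discontinuous
link and the positive part. -/
theorem not_ae_const_of_ne {U V : Set ℝ} (hU : IsOpen U) (hV : IsOpen V) (hUn : U.Nonempty)
    (hVn : V.Nonempty) (hne : ∀ x ∈ U, ∀ y ∈ V, h x ≠ h y) : ¬ ∃ a, h =ᵐ[γ₁] fun _ => a := by
  rintro ⟨a, ha⟩
  have hd := Measure.dense_of_ae
    ((gaussianReal_absolutelyContinuous' 0 one_ne_zero).ae_le ha)
  obtain ⟨x, hx, hxU⟩ := hd.exists_mem_open hU hUn
  obtain ⟨y, hy, hyV⟩ := hd.exists_mem_open hV hVn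
  exact hne x hxU y hyV (hx.trans hy.symm)

theorem not_ae_const_of_integral_iteratedDeriv_ne_zero (hc : Continuous h) (hK : 0 < K)
    (hne : ∫ z, iteratedDeriv K h z ∂γ₁ ≠ 0) : ¬ ∃ a, h =ᵐ[γ₁] fun _ => a := by
  rintro ⟨a, ha⟩
  have : h = fun _ => a := Continuous.ae_eq_iff_eq volume hc continuous_const |>.1
    ((gaussianReal_absolutelyContinuous' 0 one_ne_zero).ae_le ha)
  refine hne ?_
  simp [this, iteratedDeriv_const, hK.ne']

end Links

/-! ### The two settings -/

section Settings

local notation "γ₁" => gaussianReal 0 1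

variable {Ω : Type*} [MeasurableSpace Ω] {P : Measure Ω}
  {d : ℕ} {X : Ω → EuclideanSpace ℝ (Fin d)} {T : Ω → Bool} {Y : Ω → ℝ}
  {α β : EuclideanSpace ℝ (Fin d)} {h m : ℝ → ℝ}

theorem GaussianPopulationGLM.integrable_link (G : GaussianPopulationGLM P X T Y α β h m)
    (hm : Measurable h) {μ : Measure ℝ} [IsFiniteMeasure μ] : Integrable h μ :=
  Integrable.of_bound hm.aestronglyMeasurable 1 (Filter.Eventually.of_forall fun z => by
    rw [Real.norm_of_nonneg (G.link_nonneg z)]; exact (G.link_lt_one z).le)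

variable [IsProbabilityMeasure P]

theorem GaussianControlGLM.overlapDivergence_eq (G : GaussianControlGLM P X T Y α β h m)
    (hX : Measurable X) (hm : Measurable h) (hsq : Integrable (fun z => h z ^ 2) γ₁)
    {v : EuclideanSpace ℝ (Fin d)} (hv : ‖v‖ = 1) :
    overlapDivergence P T (fun ω => (inner ℝ v (X ω) : ℝ))
      = ENNReal.ofReal (((∫ z, h z ∂γ₁) ^ 2)⁻¹ * ∫ u, mehler (inner ℝ β v) h u ^ 2 ∂γ₁) := by
  have hr : |inner ℝ β v| ≤ 1 := (abs_inner_mem_Icc G.norm_β hv).2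
  have hc := G.link_pos
  set c := ∫ z, h z ∂γ₁ with hcdef
  have : IsFiniteMeasure (controlLaw P T) := by unfold controlLaw; infer_instance
  have : IsFiniteMeasure (treatedLaw P T) := by unfold treatedLaw; infer_instance
  have h₀ : (controlLaw P T).map X = (stdGaussian _).withDensity
      fun x => ENNReal.ofReal ((fun _ : ℝ => (1 : ℝ)) (inner ℝ β x)) := by
    rw [G.covariates]; simp only [ENNReal.ofReal_one]; exact withDensity_one.symm
  have h₁ : (treatedLaw P T).map X = (stdGaussian _).withDensity
      fun x => ENNReal.ofReal ((fun z => h z / c) (inner ℝ β x)) := by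
    rw [← Measure.withDensity_rnDeriv_eq _ _ G.overlap, withDensity_congr_ae G.density,
      G.covariates]
  rw [overlapDivergence_inner hX hv G.norm_β measurable_const (hm.div_const c)
    (fun _ => zero_le_one) (fun z => div_nonneg (G.link_nonneg z) hc.le) (integrable_const 1)
    (G.link_integrable.div_const c)
    (Filter.Eventually.of_forall fun u => by simp [mehler]) h₀ h₁]
  have hmi := strictSupport_sq.integrable_mehler hm G.link_integrable (by simp) hsq hr
  rw [← integral_const_mul, ofReal_integral_eq_lintegral_ofReal (hmi.const_mul _)
    (Filter.Eventually.of_forall fun u => by positivity)]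
  refine lintegral_congr fun u => ?_
  congr 1
  simp only [mehler, integral_div, integral_const, probReal_univ, smul_eq_mul, one_mul, div_one]
  rw [div_pow, div_eq_inv_mul]

/-- By Bayes' rule the group densities are (1 - h)/π₀ and h/π₁ at β'x. The Mehler operator fixes
constants, so f₁²/f₀ becomes (π₀/π₁²) q²/(1 - q) with q = M_r h. -/
theorem GaussianPopulationGLM.overlapDivergence_eq (G : GaussianPopulationGLM P X T Y α β h m)
    (hX : Measurable X) (hT : Measurable T) (hπ : P.real (T ⁻¹' {true}) ∈ Ioo (0 : ℝ) 1)
    (hm : Measurable h) (hψ : Integrable (fun z => h z ^ 2 / (1 - h z)) γ₁)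
    {v : EuclideanSpace ℝ (Fin d)} (hv : ‖v‖ = 1) :
    overlapDivergence P T (fun ω => (inner ℝ v (X ω) : ℝ))
      = ENNReal.ofReal ((P.real (T ⁻¹' {false}) / P.real (T ⁻¹' {true}) ^ 2) *
          ∫ u, mehler (inner ℝ β v) h u ^ 2 / (1 - mehler (inner ℝ β v) h u) ∂γ₁) := by
  have hr : |inner ℝ β v| ≤ 1 := (abs_inner_mem_Icc G.norm_β hv).2
  have hi : Integrable h γ₁ := G.integrable_link hm
  have hA : MeasurableSet (T ⁻¹' {true}) := hT (measurableSet_singleton _)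
  have hB : MeasurableSet (T ⁻¹' {false}) := hT (measurableSet_singleton _)
  have hcompl : T ⁻¹' {false} = (T ⁻¹' {true})ᶜ := by
    ext ω; simp
  have hβm : Measurable fun x : EuclideanSpace ℝ (Fin d) => (inner ℝ β x : ℝ) := by fun_prop
  have hhX : Integrable (fun ω => h (inner ℝ β (X ω))) P :=
    Integrable.of_bound (hm.comp (hβm.comp hX)).aestronglyMeasurable 1
      (Filter.Eventually.of_forall fun z => by
        rw [Real.norm_of_nonneg (G.link_nonneg _)]; exact (G.link_lt_one _).le)
  have hprop : P[(T ⁻¹' {true}).indicator (fun _ => (1 : ℝ)) | MeasurableSpace.comap X inferInstance]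
      =ᵐ[P] fun ω => h (inner ℝ β (X ω)) := by
    have e : (T ⁻¹' {true}).indicator (fun _ => (1 : ℝ))
        = fun ω => if T ω = true then (1 : ℝ) else 0 := by
      funext ω
      by_cases hω : T ω = true <;> simp [hω]
    rw [e]
    exact G.propensity
  have hprop' : P[(T ⁻¹' {false}).indicator (fun _ => (1 : ℝ)) |
      MeasurableSpace.comap X inferInstance] =ᵐ[P] fun ω => 1 - h (inner ℝ β (X ω)) := by
    have e : (T ⁻¹' {false}).indicator (fun _ => (1 : ℝ))
        = (fun _ => (1 : ℝ)) - (T ⁻¹' {true}).indicator (fun _ => (1 : ℝ)) := by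
      rw [hcompl, indicator_compl]
    rw [e]
    refine (condExp_sub (integrable_const 1) ((integrable_const 1).indicator hA) _).trans ?_
    rw [condExp_const hX.comap_le]
    filter_upwards [hprop] with ω hω
    simp [hω]
  set π₁ := P.real (T ⁻¹' {true}) with hπ₁
  have hπ₀ : P.real (T ⁻¹' {false}) = 1 - π₁ := by
    rw [hcompl, probReal_compl_eq_one_sub hA]
  set π₀ := P.real (T ⁻¹' {false}) with hπ₀def
  have hp₁ : 0 < π₁ := hπ.1
  have hp₀ : 0 < π₀ := by rw [hπ₀]; linarith [hπ.2]
  have h₁ : (treatedLaw P T).map X = (stdGaussian _).withDensity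
      fun x => ENNReal.ofReal ((fun z => h z / π₁) (inner ℝ β x)) := by
    rw [treatedLaw, cond_map_eq_withDensity (f := fun x => h (inner ℝ β x)) hX hA (hm.comp hβm)
      (fun x => G.link_nonneg _) hhX hprop, G.covariates]
  have h₀ : (controlLaw P T).map X = (stdGaussian _).withDensity
      fun x => ENNReal.ofReal ((fun z => (1 - h z) / π₀) (inner ℝ β x)) := by
    rw [controlLaw, cond_map_eq_withDensity (f := fun x => 1 - h (inner ℝ β x)) hX hB
      ((hm.comp hβm).const_sub 1) (fun x => sub_nonneg.2 (G.link_lt_one _).le)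
      ((integrable_const 1).sub hhX) hprop', G.covariates]
  have hS : ∀ᵐ x ∂γ₁, h x ∈ Iio 1 := Filter.Eventually.of_forall G.link_lt_one
  have hq := strictSupport_sq_div.ae_mehler hi hS hψ hr
  have hmk₀ : ∀ᵐ u ∂γ₁, mehler (inner ℝ β v) (fun z => (1 - h z) / π₀) u
      = (1 - mehler (inner ℝ β v) h u) / π₀ := by
    filter_upwards [ae_integrable_mehler hr hi] with u hu
    simp only [mehler, integral_div]
    rw [integral_sub (integrable_const 1) hu]
    simp
  rw [overlapDivergence_inner hX hv G.norm_β ((hm.const_sub 1).div_const π₀) (hm.div_const π₁)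
    (fun z => div_nonneg (sub_nonneg.2 (G.link_lt_one z).le) hp₀.le)
    (fun z => div_nonneg (G.link_nonneg z) hp₁.le)
    (((integrable_const 1).sub hi).div_const π₀) (hi.div_const π₁)
    (by
      filter_upwards [hmk₀, hq] with u hu hu'
      rw [hu]
      exact div_pos (sub_pos.2 hu'.1) hp₀) h₀ h₁]
  have hmi := strictSupport_sq_div.integrable_mehler hm hi hS hψ hr
  rw [← integral_const_mul, ofReal_integral_eq_lintegral_ofReal (hmi.const_mul _)
    (by
      filter_upwards [hq] with u hu
      exact mul_nonneg (by positivity) (strictSupport_sq_div.nonneg _ hu.1))]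
  refine lintegral_congr_ae ?_
  filter_upwards [hmk₀, hq] with u hu hu'
  have hne : 1 - mehler (inner ℝ β v) h u ≠ 0 := (sub_pos.2 hu'.1).ne'
  have hk₁ : mehler (inner ℝ β v) (fun z => h z / π₁) u = mehler (inner ℝ β v) h u / π₁ := by
    simp only [mehler, integral_div]
  rw [hu, hk₁]
  congr 1
  field_simp

theorem GaussianControlGLM.nondecreasingInAssociation (G : GaussianControlGLM P X T Y α β h m)
    (hX : Measurable X) (hm : Measurable h) (hsq : Integrable (fun z => h z ^ 2) γ₁) :
    NondecreasingInAssociation β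
      fun v => overlapDivergence P T (fun ω => (inner ℝ v (X ω) : ℝ)) :=
  strictSupport_sq.nondecreasingInAssociation hm G.link_integrable (by simp) hsq
    (inv_pos.2 (pow_pos G.link_pos 2)) fun _ hv => G.overlapDivergence_eq hX hm hsq hv

theorem GaussianControlGLM.increasingInAssociation (G : GaussianControlGLM P X T Y α β h m)
    (hX : Measurable X) (hm : Measurable h) (hsq : Integrable (fun z => h z ^ 2) γ₁)
    (hconst : ¬ ∃ a, h =ᵐ[γ₁] fun _ => a) :
    IncreasingInAssociation β
      fun v => overlapDivergence P T (fun ω => (inner ℝ v (X ω) : ℝ)) :=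
  strictSupport_sq.increasingInAssociation hm G.link_nonneg G.link_integrable (by simp) hsq hconst
    (inv_pos.2 (pow_pos G.link_pos 2)) fun _ hv => G.overlapDivergence_eq hX hm hsq hv

theorem GaussianPopulationGLM.constant_pos (hT : Measurable T)
    (hπ : P.real (T ⁻¹' {true}) ∈ Ioo (0 : ℝ) 1) :
    0 < P.real (T ⁻¹' {false}) / P.real (T ⁻¹' {true}) ^ 2 := by
  have hcompl : T ⁻¹' {false} = (T ⁻¹' {true})ᶜ := by
    ext ω; simp
  rw [hcompl, probReal_compl_eq_one_sub (hT (measurableSet_singleton _))]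
  exact div_pos (sub_pos.2 hπ.2) (pow_pos hπ.1 2)

theorem GaussianPopulationGLM.nondecreasingInAssociation
    (G : GaussianPopulationGLM P X T Y α β h m) (hX : Measurable X) (hT : Measurable T)
    (hπ : P.real (T ⁻¹' {true}) ∈ Ioo (0 : ℝ) 1) (hm : Measurable h)
    (hψ : Integrable (fun z => h z ^ 2 / (1 - h z)) γ₁) :
    NondecreasingInAssociation β
      fun v => overlapDivergence P T (fun ω => (inner ℝ v (X ω) : ℝ)) :=
  strictSupport_sq_div.nondecreasingInAssociation hm (G.integrable_link hm)
    (Filter.Eventually.of_forall G.link_lt_one) hψ (constant_pos hT hπ)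
    fun _ hv => G.overlapDivergence_eq hX hT hπ hm hψ hv

theorem GaussianPopulationGLM.increasingInAssociation
    (G : GaussianPopulationGLM P X T Y α β h m) (hX : Measurable X) (hT : Measurable T)
    (hπ : P.real (T ⁻¹' {true}) ∈ Ioo (0 : ℝ) 1) (hm : Measurable h)
    (hψ : Integrable (fun z => h z ^ 2 / (1 - h z)) γ₁)
    (hconst : ¬ ∃ a, h =ᵐ[γ₁] fun _ => a) :
    IncreasingInAssociation β
      fun v => overlapDivergence P T (fun ω => (inner ℝ v (X ω) : ℝ)) :=
  strictSupport_sq_div.increasingInAssociation hm G.link_nonneg (G.integrable_link hm)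
    (Filter.Eventually.of_forall G.link_lt_one) hψ hconst (constant_pos hT hπ)
    fun _ hv => G.overlapDivergence_eq hX hT hπ hm hψ hv

end Settings

theorem theorem2 {Ω : Type*} [MeasurableSpace Ω] (P : Measure Ω) [IsProbabilityMeasure P]
    {d : ℕ} (X : Ω → EuclideanSpace ℝ (Fin d)) (T : Ω → Bool) (Y : Ω → ℝ)
    (hX : Measurable X) (hT : Measurable T) (hY : Integrable Y P)
    (hπ : P.real (T ⁻¹' {true}) ∈ Ioo (0 : ℝ) 1)
    (α β : EuclideanSpace ℝ (Fin d)) (h m : ℝ → ℝ)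
    (C lam lam' : ℝ) (hC : 1 < C) (hlam : 0 ≤ lam ∧ lam < 1 / 4)
    (hlam' : 0 ≤ lam' ∧ lam' < (1 - 4 * lam) / 6)
    (O : EuclideanSpace ℝ (Fin d) → ℝ≥0∞)
    (hO : O = fun γ => overlapDivergence P T (fun ω => (inner ℝ γ (X ω) : ℝ))) :
    (((GaussianControlGLM P X T Y α β h m ∧ h ∈ linkClass 2 C lam) ∨
      (GaussianPopulationGLM P X T Y α β h m ∧ h ∈ propensityLinkClass 2 C lam lam')) →
        NondecreasingInAssociation β O ∧
        (inner ℝ α β ≠ (0 : ℝ) →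
          NondecreasingAlongFamily α β O ∧ {α, -α} ⊆ familyMinimizers α β O) ∧
        (inner ℝ α β = (0 : ℝ) → projectsToSegment α β ⊆ familyMinimizers α β O)) ∧
    (((GaussianControlGLM P X T Y α β h m ∧
          ((∃ K : ℕ, 2 ≤ K ∧ h ∈ linkClass (K + 1) C lam ∧
              ∫ z, iteratedDeriv K h z ∂(gaussianReal 0 1) ≠ 0) ∨
           (∃ z₀ : ℝ, h = fun z => if z ≤ z₀ then 1 else 0) ∨
           h = fun z => max 0 z)) ∨
      (GaussianPopulationGLM P X T Y α β h m ∧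
          ∃ K : ℕ, 2 ≤ K ∧ h ∈ propensityLinkClass (K + 1) C lam lam' ∧
            ∫ z, iteratedDeriv K h z ∂(gaussianReal 0 1) ≠ 0)) →
        IncreasingInAssociation β O ∧
        (inner ℝ α β ≠ (0 : ℝ) →
          IncreasingAlongFamily α β O ∧ familyMinimizers α β O = {α, -α}) ∧
        (inner ℝ α β = (0 : ℝ) → familyMinimizers α β O = projectsToSegment α β)) := by
  subst hO
  -- Here λ' < (1 - 4λ)/6 ≤ 1/6; a rate below 1/2 is what Gaussian integrability of 1/(1 - h)
  -- requires.
  have hl' : lam' < 1 / 2 := by linarith [hlam.1, hlam'.2]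
  have hC0 : 0 < C := by linarith
  refine ⟨fun H => ?_, fun H => ?_⟩
  · have hgeom : ‖α‖ = 1 ∧ ‖β‖ = 1 ∧ inner ℝ α β ∈ Ioo (-1 : ℝ) 1 := by
      rcases H with ⟨G, -⟩ | ⟨G, -⟩ <;> exact ⟨G.norm_α, G.norm_β, G.inner_mem⟩
    obtain ⟨hα, hβ, hρ⟩ := hgeom
    have hmono : NondecreasingInAssociation β
        fun v => overlapDivergence P T (fun ω => (inner ℝ v (X ω) : ℝ)) := by
      rcases H with ⟨G, hh⟩ | ⟨G, hh⟩
      · exact G.nondecreasingInAssociation hX (hh.1.continuous two_pos).measurable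
          (integrable_sq_of_mem_linkClass hh two_pos hlam.2)
      · exact G.nondecreasingInAssociation hX hT hπ (hh.1.continuous two_pos).measurable
          (integrable_of_mem_propensityLinkClass hh two_pos hC0 hl' G.link_lt_one)
    exact ⟨hmono, fun h0 => ⟨hmono.alongFamily hα hβ hρ h0, hmono.pair_subset hα hβ hρ⟩,
      fun h0 => hmono.projectsToSegment_subset hα hβ h0⟩
  · have hgeom : ‖α‖ = 1 ∧ ‖β‖ = 1 ∧ inner ℝ α β ∈ Ioo (-1 : ℝ) 1 := by
      rcases H with ⟨G, -⟩ | ⟨G, -⟩ <;> exact ⟨G.norm_α, G.norm_β, G.inner_mem⟩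
    obtain ⟨hα, hβ, hρ⟩ := hgeom
    have hmono : IncreasingInAssociation β
        fun v => overlapDivergence P T (fun ω => (inner ℝ v (X ω) : ℝ)) := by
      rcases H with ⟨G, ⟨K, hK, hh, hne⟩ | ⟨z₀, rfl⟩ | rfl⟩ | ⟨G, K, hK, hh, hne⟩
      · have hc := hh.1.continuous K.succ_pos
        exact G.increasingInAssociation hX hc.measurable
          (integrable_sq_of_mem_linkClass hh K.succ_pos hlam.2)
          (not_ae_const_of_integral_iteratedDeriv_ne_zero hc (by omega) hne)
      · have hm : Measurable fun z : ℝ => if z ≤ z₀ then (1 : ℝ) else 0 :=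
          Measurable.ite measurableSet_Iic measurable_const measurable_const
        refine G.increasingInAssociation hX hm ?_ ?_
        · refine Integrable.of_bound (hm.pow_const 2).aestronglyMeasurable 1
            (Filter.Eventually.of_forall fun z => ?_)
          by_cases hz : z ≤ z₀ <;> simp [hz]
        · refine not_ae_const_of_ne (U := Iio z₀) (V := Ioi z₀) isOpen_Iio isOpen_Ioi
            nonempty_Iio nonempty_Ioi fun x hx y hy => ?_
          simp [le_of_lt (mem_Iio.1 hx), not_le.2 (mem_Ioi.1 hy)]
      · have hc : Continuous fun z : ℝ => max 0 z := by fun_prop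
        refine G.increasingInAssociation hX hc.measurable ?_ ?_
        · refine (memLp_id_gaussianReal 2).integrable_sq.mono'
            (hc.pow 2).aestronglyMeasurable (Filter.Eventually.of_forall fun z => ?_)
          rw [Real.norm_of_nonneg (sq_nonneg _)]
          rcases le_total z 0 with hz | hz
          · simpa [max_eq_left hz] using sq_nonneg z
          · simp [max_eq_right hz]
        · refine not_ae_const_of_ne (U := Iio 0) (V := Ioi 0) isOpen_Iio isOpen_Ioi
            nonempty_Iio nonempty_Ioi fun x hx y hy => ?_
          rw [max_eq_left (le_of_lt (mem_Iio.1 hx)), max_eq_right (le_of_lt (mem_Ioi.1 hy))]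
          exact (mem_Ioi.1 hy).ne
      · have hc := hh.1.continuous K.succ_pos
        exact G.increasingInAssociation hX hT hπ hc.measurable
          (integrable_of_mem_propensityLinkClass hh K.succ_pos hC0 hl' G.link_lt_one)
          (not_ae_const_of_integral_iteratedDeriv_ne_zero hc (by omega) hne)
    exact ⟨hmono, fun h0 => ⟨hmono.alongFamily hα hβ hρ h0,
      hmono.familyMinimizers_eq_pair hα hβ hρ h0⟩,
      fun h0 => hmono.familyMinimizers_eq_projectsToSegment hα hβ h0⟩
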